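/- In the two-player additive-split model, Alice holds $x$ and Bob holds $y$, where $x,y$ are $n\times n$ matrices over the finite field $\mathbb{F}_p$, $p$ prime. For a partial function $f$ of $(x,y)$, let $\mathrm{R}^{\mathrm{pub}}_{1/10}(f)$ be the public-coin randomized communication complexity of $f$ with error $1/10$: the least $c$ such that some public-coin two-party protocol (a probability distribution on deterministic protocol trees) that always exchanges at most $c$ bits outputs the correct value with probability at least $9/10$ on every input pair on which $f$ is defined. Consider the following problems. - $\mathrm{Rank}_{n,n-1}$: under the promise that $\operatorname{rank}(x+y)\in\{n-1,n\}$, compute $\operatorname{rank}(x+y)$. - $\mathrm{Inverse}_n$: under the promise that $x+y$ is invertible, decide whether the $(1,1)$ entry of $(x+y)^{-1}$ is zero. - $\mathrm{SolveLinearSystem}_{n,b}$, for a fixed non-zero vector $b\in\mathbb{F}_p^n$: under the promise that $x+y$ is invertible, decide whether $t_1=0$, where $t$ is the solution of $(x+y)t=b$. There are absolute constants $c>0$ and $n_0$ such that, for all $n\ge n_0$ and all primes $p$, if $f$ is $\mathrm{Rank}_{n,n-1}$, $\mathrm{Inverse}_n$, or $\mathrm{SolveLinearSystem}_{n,b}$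 for some non-zero $b\in\mathbb{F}_p^n$, then $$\mathrm{R}^{\mathrm{pub}}_{1/10}(f)\ \ge\ c\,n^2\log p.$$ -/

import Mathlib

/-- A deterministic two-player communication protocol on inputs `x : X` (Alice) and `y : Y` (Bob)
with outputs in `Z`, as a binary protocol tree: at an inner node one of the players sends a bit
that depends on that player's own input and on the node (so on all bits exchanged before), and the
leaf that is reached carries the output. -/
inductive Protocol (X Y Z : Type) : Type
  | leaf (out : Z) : Protocol X Y Z
  | alice (bit : X → Bool) (next : Bool → Protocol X Y Z) : Protocol X Y Z
  | bob (bit : Y → Bool) (next : Bool → Protocol X Y Z) : Protocol X Y Z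

namespace Protocol

variable {X Y Z : Type}

/-- The output of the protocol on the input pair `(x, y)`. -/
def run : Protocol X Y Z → X → Y → Z
  | leaf out, _, _ => out
  | alice bit next, x, y => (next (bit x)).run x y
  | bob bit next, x, y => (next (bit y)).run x y

/-- The worst-case number of bits exchanged, i.e. the depth of the protocol tree. -/
def cost : Protocol X Y Z → ℕ
  | leaf _ => 0
  | alice _ next => max (next false).cost (next true).cost + 1
  | bob _ next => max (next false).cost (next true).cost + 1

end Protocol

/-- A two-player promise problem: for input pairs that satisfy the promise, the players have to
output `answer x y`; on all other input pairs every output is allowed. -/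
structure PromiseProblem (X Y Z : Type) where
  promise : X → Y → Prop
  answer : X → Y → Z

/-- A public-coin randomized protocol is a probability distribution `μ` on deterministic protocols:
the public coins select the deterministic protocol to be run. (Private coins can be made part
of the public ones.) It solves `P` with error `δ` if, on each input pair that satisfies the promise,
the probability of a wrong output is at most `δ`. -/
def SolvesWithError {X Y Z : Type} (μ : PMF (Protocol X Y Z)) (P : PromiseProblem X Y Z)
    (δ : ℝ) : Prop :=
  ∀ x y, P.promise x y → (μ.toOuterMeasure {π | π.run x y ≠ P.answer x y}).toReal ≤ δ

/-- The public-coin randomized communication complexity of `P` with error `δ`: the least `c` such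
that some public-coin protocol that solves `P` with error `δ` never exchanges more than `c` bits. -/
noncomputable def publicCoinComplexity {X Y Z : Type} (δ : ℝ) (P : PromiseProblem X Y Z) : ℕ :=
  sInf {c : ℕ | ∃ μ : PMF (Protocol X Y Z),
    (∀ π ∈ μ.support, π.cost ≤ c) ∧ SolvesWithError μ P δ}

/-- On finite input sets every function is computed by some deterministic protocol. -/
theorem Protocol.exists_run_eq {X Y Z : Type} [Finite X] [Finite Y] [Nonempty Z]
    (F : X → Y → Z) : ∃ π : Protocol X Y Z, ∀ x y, π.run x y = F x y := by
  classical
  have hb : ∀ (g : Y → Z) (l : List Y),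
      ∃ π : Protocol X Y Z, ∀ x, ∀ y ∈ l, π.run x y = g y := by
    intro g l
    induction l with
    | nil => exact ⟨.leaf (Classical.arbitrary Z), by simp⟩
    | cons a l ih =>
      obtain ⟨π, hπ⟩ := ih
      refine ⟨.bob (fun y => decide (y = a)) (fun s => bif s then .leaf (g a) else π), ?_⟩
      intro x y hy
      by_cases h : y = a
      · simp [Protocol.run, h]
      · have : y ∈ l := by simpa [h] using hy
        simp [Protocol.run, h, hπ x y this]
  obtain ⟨ly, hly⟩ := Finite.exists_univ_list Y
  obtain ⟨lx, hlx⟩ := Finite.exists_univ_list X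
  have ha : ∀ l : List X, ∃ π : Protocol X Y Z, ∀ x ∈ l, ∀ y, π.run x y = F x y := by
    intro l
    induction l with
    | nil =>
      exact ⟨.leaf (Classical.arbitrary Z), by simp⟩
    | cons a l ih =>
      obtain ⟨π, hπ⟩ := ih
      obtain ⟨ρ, hρ⟩ := hb (F a) ly
      refine ⟨.alice (fun x => decide (x = a)) (fun s => bif s then ρ else π), ?_⟩
      intro x hx y
      by_cases h : x = a
      · subst h
        simp [Protocol.run, hρ x y (hly.2 y)]
      · have : x ∈ l := by simpa [h] using hx
        simp [Protocol.run, h, hπ x this y]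
  obtain ⟨π, hπ⟩ := ha lx
  exact ⟨π, fun x y => hπ x (hlx.2 x) y⟩

/-- On finite input sets the infimum that defines the complexity is attained. -/
theorem exists_publicCoinComplexity {X Y Z : Type} [Finite X] [Finite Y] [Nonempty Z] {δ : ℝ}
    (hδ : 0 ≤ δ) (P : PromiseProblem X Y Z) :
    ∃ μ : PMF (Protocol X Y Z),
      (∀ π ∈ μ.support, π.cost ≤ publicCoinComplexity δ P) ∧ SolvesWithError μ P δ := by
  obtain ⟨π, hπ⟩ := Protocol.exists_run_eq P.answer
  have hne : {c : ℕ | ∃ μ : PMF (Protocol X Y Z),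
      (∀ π ∈ μ.support, π.cost ≤ c) ∧ SolvesWithError μ P δ}.Nonempty := by
    refine ⟨π.cost, PMF.pure π, ?_, ?_⟩
    · intro ρ hρ
      simp only [PMF.support_pure, Set.mem_singleton_iff] at hρ
      rw [hρ]
    · intro x y _
      simpa [PMF.toOuterMeasure_pure_apply, hπ] using hδ
  exact Nat.sInf_mem hne

section MatrixProblems

open Matrix

/-- Alice holds `x`, Bob holds `y`; under the promise that the rank of `x + y` is `k` or `k + 1`,
compute this rank. -/
noncomputable def rankProblem (p n k : ℕ) [Fact p.Prime] :
    PromiseProblem (Matrix (Fin n) (Fin n) (ZMod p)) (Matrix (Fin n) (Fin n) (ZMod p)) ℕ where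
  promise x y := (x + y).rank = k ∨ (x + y).rank = k + 1
  answer x y := (x + y).rank

/-- Under the promise that `x + y` is invertible, decide whether the top-left entry of its inverse
is zero. -/
noncomputable def inverseProblem (p n : ℕ) [Fact p.Prime] [NeZero n] :
    PromiseProblem (Matrix (Fin n) (Fin n) (ZMod p)) (Matrix (Fin n) (Fin n) (ZMod p)) Bool where
  promise x y := IsUnit (x + y)
  answer x y := decide ((x + y)⁻¹ 0 0 = 0)

open Classical in
/-- Under the promise that `x + y` is invertible, decide whether the first coordinate of the
solution `t` of the linear system `(x + y) t = b` is zero. -/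
noncomputable def solveLinearSystemProblem (p n : ℕ) [Fact p.Prime] [NeZero n]
    (b : Fin n → ZMod p) :
    PromiseProblem (Matrix (Fin n) (Fin n) (ZMod p)) (Matrix (Fin n) (Fin n) (ZMod p)) Bool where
  promise x y := IsUnit (x + y)
  answer x y := decide (∃ t : Fin n → ZMod p, (x + y) *ᵥ t = b ∧ t 0 = 0)

end MatrixProblems

/-! The proof is a discrepancy argument with a signed witness `g (x + y)`. Let G be the group of n ×
n matrices over a field with q elements, and let g be the Fourier transform of the indicator
function of the invertible matrices. Its Fourier coefficients are 0 or 1, so Parseval bounds its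
correlation with every rectangle by |G|², and a protocol of cost c, being a mixture of partitions
into at most 2^c rectangles, has correlation at most 2^c |G|².

`sum_addChar_linearIndependent` evaluates g: up to a global sign it is (-1)^t q^(n choose 2) ∏_{i ≤
t} (q^i - 1) at corank t. A moment count (`card_corank_mul_le`) bounds the number of matrices of
corank t, and the mass of |g| there is at most |G| q^(n choose 2) / q^(t choose 2). A protocol for
the rank problem collects most of the positive mass at corank 0 and at most a tenth of the negative
mass at corank 1. Outside the promise, even coranks contribute nonnegatively and odd coranks from 3
on carry too little mass to cancel the gain. So the correlation is at least |G|² q^(n choose 2) /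
100, which forces q^(n choose 2) ≤ 100 · 2^c.

For the inverse, Cramer's rule turns the question into singularity of the minor without first row
and column, so the witness is g of that minor. The protocol is uncontrolled where x + y is singular.
Hence the witness is multiplied by `corankSieve`, a polynomial of degree 15 in q^corank(x + y) that
is 1 at corank 0 and vanishes at coranks 1 to 15. A factor q^corank costs only q^(2n) in the
rectangle bound (`RectangleBound.pow_corank_mul`), so the total loss q^O(n) is harmless, and coranks
from 16 on are rare enough to be absorbed. A linear system with b = M e₁ is the inverse problem for
M⁻¹(x + y). -/

/-! ### Rectangle correlation of deterministic and randomized protocols. -/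

/-- Every combinatorial rectangle has correlation at most `B` with the function `g (x + y)`. -/
def RectangleBound {G : Type} [Add G] (g : G → ℝ) (B : ℝ) : Prop :=
  ∀ S T : Finset G, |∑ x ∈ S, ∑ y ∈ T, g (x + y)| ≤ B

theorem RectangleBound.nonneg {G : Type} [Add G] {g : G → ℝ} {B : ℝ}
    (h : RectangleBound g B) : 0 ≤ B := by
  simpa using h ∅ ∅

open Classical in
/-- The set where a protocol's output lies in `E` is a disjoint union of at most `2 ^ cost`
rectangles. -/
theorem RectangleBound.protocol {G Z : Type} [Add G] {g : G → ℝ} {B : ℝ}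
    (h : RectangleBound g B) (E : Set Z) (π : Protocol G G Z) (S T : Finset G) :
    |∑ x ∈ S, ∑ y ∈ T, g (x + y) * (if π.run x y ∈ E then 1 else 0)| ≤ 2 ^ π.cost * B := by
  have hB := h.nonneg
  have key : ∀ (a b : ℕ) (u v : ℝ), |u| ≤ 2 ^ a * B → |v| ≤ 2 ^ b * B →
      |u + v| ≤ 2 ^ (max b a + 1) * B := by
    intro a b u v hu hv
    have h1 : (2 : ℝ) ^ a * B ≤ 2 ^ (max b a) * B := by
      gcongr
      · norm_num
      · exact le_max_right _ _
    have h2 : (2 : ℝ) ^ b * B ≤ 2 ^ (max b a) * B := by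
      gcongr
      · norm_num
      · exact le_max_left _ _
    rw [pow_succ]
    linarith [abs_add_le u v]
  -- The rectangle varies in the induction because each transmitted bit cuts it in two.
  induction π generalizing S T with
  | leaf out =>
    by_cases ho : out ∈ E
    · simpa [Protocol.run, Protocol.cost, ho] using h S T
    · simpa [Protocol.run, Protocol.cost, ho] using hB
  | alice bit next ih =>
    rw [← Finset.sum_filter_add_sum_filter_not S (fun x => bit x = true)]
    refine key _ _ _ _ (le_trans (le_of_eq ?_) (ih true (S.filter fun x => bit x = true) T))
      (le_trans (le_of_eq ?_) (ih false (S.filter fun x => ¬ bit x = true) T))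
    · congr 1
      refine Finset.sum_congr rfl fun x hx => ?_
      simp [Protocol.run, (Finset.mem_filter.1 hx).2]
    · congr 1
      refine Finset.sum_congr rfl fun x hx => ?_
      have : bit x = false := by simpa using (Finset.mem_filter.1 hx).2
      simp [Protocol.run, this]
  | bob bit next ih =>
    have hs : ∀ x, ∑ y ∈ T, g (x + y) * (if (Protocol.bob bit next).run x y ∈ E then 1 else 0)
        = ∑ y ∈ T.filter (fun y => bit y = true),
            g (x + y) * (if (next true).run x y ∈ E then 1 else 0)
          + ∑ y ∈ T.filter (fun y => ¬ bit y = true),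
            g (x + y) * (if (next false).run x y ∈ E then 1 else 0) := by
      intro x
      rw [← Finset.sum_filter_add_sum_filter_not T (fun y => bit y = true)]
      congr 1
      · refine Finset.sum_congr rfl fun y hy => ?_
        simp [Protocol.run, (Finset.mem_filter.1 hy).2]
      · refine Finset.sum_congr rfl fun y hy => ?_
        have : bit y = false := by simpa using (Finset.mem_filter.1 hy).2
        simp [Protocol.run, this]
    simp only [hs, Finset.sum_add_distrib]
    exact key _ _ _ _ (ih true S _) (ih false S _)

theorem PMF.summable_toReal {α : Type} (μ : PMF α) : Summable fun a => (μ a).toReal :=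
  ENNReal.summable_toReal (by rw [μ.tsum_coe]; exact ENNReal.one_ne_top)

theorem PMF.tsum_toReal {α : Type} (μ : PMF α) : ∑' a, (μ a).toReal = 1 := by
  rw [← ENNReal.tsum_toReal_eq (fun a => μ.apply_ne_top a), μ.tsum_coe, ENNReal.toReal_one]

open Classical in
theorem PMF.toReal_toOuterMeasure {α : Type} (μ : PMF α) (s : Set α) :
    (μ.toOuterMeasure s).toReal = ∑' a, (μ a).toReal * (if a ∈ s then 1 else 0) := by
  rw [PMF.toOuterMeasure_apply, ENNReal.tsum_toReal_eq]
  · refine tsum_congr fun a => ?_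
    by_cases h : a ∈ s <;> simp [h]
  · intro a
    by_cases h : a ∈ s <;> simp [h, μ.apply_ne_top a]

open Classical in
theorem PMF.summable_toReal_ite {α : Type} (μ : PMF α) (s : Set α) :
    Summable fun a => (μ a).toReal * (if a ∈ s then (1 : ℝ) else 0) := by
  refine Summable.of_nonneg_of_le (fun a => by positivity) (fun a => ?_) μ.summable_toReal
  by_cases h : a ∈ s <;> simp [h]

theorem PMF.toReal_toOuterMeasure_compl {α : Type} (μ : PMF α) (s : Set α) :
    (μ.toOuterMeasure s).toReal + (μ.toOuterMeasure sᶜ).toReal = 1 := by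
  classical
  rw [PMF.toReal_toOuterMeasure, PMF.toReal_toOuterMeasure, ← Summable.tsum_add
    (μ.summable_toReal_ite s) (μ.summable_toReal_ite sᶜ)]
  refine Eq.trans ?_ μ.tsum_toReal
  refine tsum_congr fun a => ?_
  by_cases h : a ∈ s <;> simp [h]

theorem PMF.toReal_toOuterMeasure_mono {α : Type} (μ : PMF α) {s t : Set α} (h : s ⊆ t) :
    (μ.toOuterMeasure s).toReal ≤ (μ.toOuterMeasure t).toReal := by
  classical
  rw [PMF.toReal_toOuterMeasure, PMF.toReal_toOuterMeasure]
  refine Summable.tsum_le_tsum (fun a => ?_) (μ.summable_toReal_ite s) (μ.summable_toReal_ite t)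
  by_cases hs : a ∈ s
  · simp [hs, h hs]
  · simp only [hs, if_false, mul_zero]
    positivity

/-- The correlation of a randomized protocol of cost `c` with `g (x + y)`. -/
theorem RectangleBound.randomized {G Z : Type} [Add G] [Fintype G] {g : G → ℝ} {B : ℝ}
    (h : RectangleBound g B) (E : Set Z) (μ : PMF (Protocol G G Z)) {c : ℕ}
    (hc : ∀ π ∈ μ.support, π.cost ≤ c) :
    ∑ x, ∑ y, g (x + y) * (μ.toOuterMeasure {π | π.run x y ∈ E}).toReal ≤ 2 ^ c * B := by
  classical
  have hB := h.nonneg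
  have hsum : ∀ x y : G, Summable fun π : Protocol G G Z =>
      g (x + y) * ((μ π).toReal * (if π.run x y ∈ E then (1 : ℝ) else 0)) := fun x y =>
    (μ.summable_toReal_ite {π | π.run x y ∈ E}).mul_left _
  have hrw : ∑ x, ∑ y, g (x + y) * (μ.toOuterMeasure {π | π.run x y ∈ E}).toReal
      = ∑' π, ∑ x, ∑ y, g (x + y) * ((μ π).toReal * (if π.run x y ∈ E then (1 : ℝ) else 0)) := by
    rw [Summable.tsum_finsetSum fun x _ => summable_sum fun y _ => hsum x y]
    refine Finset.sum_congr rfl fun x _ => ?_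
    rw [Summable.tsum_finsetSum fun y _ => hsum x y]
    refine Finset.sum_congr rfl fun y _ => ?_
    rw [PMF.toReal_toOuterMeasure, tsum_mul_left]
    rfl
  rw [hrw]
  calc _ ≤ ∑' π, (μ π).toReal * (2 ^ c * B) := by
        refine Summable.tsum_le_tsum (fun π => ?_)
          (summable_sum fun x _ => summable_sum fun y _ => hsum x y) (μ.summable_toReal.mul_right _)
        have : ∑ x, ∑ y, g (x + y) * ((μ π).toReal * (if π.run x y ∈ E then (1 : ℝ) else 0))
            = (μ π).toReal * ∑ x, ∑ y, g (x + y) * (if π.run x y ∈ E then (1 : ℝ) else 0) := by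
          rw [Finset.mul_sum]
          refine Finset.sum_congr rfl fun x _ => ?_
          rw [Finset.mul_sum]
          exact Finset.sum_congr rfl fun y _ => by ring
        rw [this]
        by_cases h0 : μ π = 0
        · simp [h0]
        · refine mul_le_mul_of_nonneg_left ?_ ENNReal.toReal_nonneg
          refine (le_abs_self _).trans ((h.protocol E π Finset.univ Finset.univ).trans ?_)
          gcongr
          · norm_num
          · exact hc π ((μ.mem_support_iff π).2 h0)
    _ = 2 ^ c * B := by rw [tsum_mul_right, μ.tsum_toReal, one_mul]

/-- The lower bound obtained from a witness `g`: `φ` is a pointwise lower bound for `g` times the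
acceptance probability of any protocol that solves the problem with error `δ`. -/
theorem card_mul_sum_le_of_rectangleBound {G Z : Type} [AddCommGroup G] [Fintype G] [Nonempty Z]
    {g φ : G → ℝ} {B δ : ℝ} (hδ : 0 ≤ δ) (h : RectangleBound g B) (P : PromiseProblem G G Z)
    (E : Set Z)
    (hφ : ∀ x y : G, ∀ a : ℝ, 0 ≤ a → a ≤ 1 → (P.promise x y → P.answer x y ∈ E → 1 - δ ≤ a) →
      (P.promise x y → P.answer x y ∉ E → a ≤ δ) → φ (x + y) ≤ g (x + y) * a) :
    (Fintype.card G : ℝ) * ∑ z, φ z ≤ 2 ^ publicCoinComplexity δ P * B := by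
  obtain ⟨μ, hc, hμ⟩ := exists_publicCoinComplexity hδ P
  refine le_trans ?_ (h.randomized E μ hc)
  have : (Fintype.card G : ℝ) * ∑ z, φ z = ∑ x : G, ∑ y : G, φ (x + y) := by
    have hx : ∀ x : G, ∑ y : G, φ (x + y) = ∑ z, φ z := fun x =>
      Fintype.sum_equiv (Equiv.addLeft x) _ _ fun y => rfl
    simp [hx]
  rw [this]
  refine Finset.sum_le_sum fun x _ => Finset.sum_le_sum fun y _ => ?_
  have hcompl := μ.toReal_toOuterMeasure_compl {π | π.run x y ∈ E}
  have h0 : 0 ≤ (μ.toOuterMeasure {π | π.run x y ∈ E}ᶜ).toReal := ENNReal.toReal_nonneg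
  refine hφ x y _ ENNReal.toReal_nonneg (by linarith) (fun hp hE => ?_) (fun hp hE => ?_)
  · have h1 := μ.toReal_toOuterMeasure_mono (s := {π | π.run x y ∈ E}ᶜ)
      (t := {π | π.run x y ≠ P.answer x y}) fun π hπ hπ' => hπ (by
        show π.run x y ∈ E
        rw [hπ']; exact hE)
    linarith [hμ x y hp]
  · refine (μ.toReal_toOuterMeasure_mono (t := {π | π.run x y ≠ P.answer x y})
      fun π hπ hπ' => hE ?_).trans (hμ x y hp)
    rw [← hπ']; exact hπ

/-! ### Character sums over linearly independent families. -/

section CharacterSums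

set_option linter.unusedSectionVars false

open Module

variable {F : Type} [Field F] [Fintype F] (ψ : AddChar F ℂ)

theorem sum_addChar_linearMap (hψ : ψ ≠ 1) {V : Type} [AddCommGroup V] [Module F V] [Fintype V]
    {φ : V →ₗ[F] F} (hφ : φ ≠ 0) : ∑ v, ψ (φ v) = 0 := by
  have h : ψ.compAddMonoidHom φ.toAddMonoidHom ≠ 1 := by
    obtain ⟨a, ha⟩ := AddChar.ne_one_iff.1 hψ
    obtain ⟨v, rfl⟩ := LinearMap.surjective hφ a
    exact AddChar.ne_one_iff.2 ⟨v, ha⟩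
  exact AddChar.sum_eq_zero_of_ne_one h

open Classical in
theorem sum_addChar_submodule (hψ : ψ ≠ 1) {V : Type} [AddCommGroup V] [Module F V] [Fintype V]
    (φ : V →ₗ[F] F) (W : Submodule F V) :
    ∑ v with v ∈ W, ψ (φ v) =
      if W ≤ LinearMap.ker φ then (Fintype.card F : ℂ) ^ finrank F W else 0 := by
  have h1 : ∑ v with v ∈ W, ψ (φ v) = ∑ w : W, ψ ((φ.domRestrict W) w) := by
    rw [← Finset.sum_subtype_eq_sum_filter, Finset.subtype_univ]
    rfl
  rw [h1]
  split_ifs with h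
  · have : ∀ w : W, φ.domRestrict W w = 0 := fun w => h w.2
    simp only [this, AddChar.map_zero_eq_one, Finset.sum_const, Finset.card_univ, nsmul_eq_mul,
      mul_one]
    rw [Module.card_eq_pow_finrank (K := F) (V := W)]
    push_cast
    rfl
  · refine sum_addChar_linearMap ψ hψ fun h0 => h fun w hw => ?_
    exact LinearMap.congr_fun h0 ⟨w, hw⟩

open Classical in
theorem sum_addChar_compl_submodule (hψ : ψ ≠ 1) {V : Type} [AddCommGroup V] [Module F V]
    [Fintype V] (φ : V →ₗ[F] F) (W : Submodule F V) :
    ∑ v with v ∉ W, ψ (φ v) =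
      (if φ = 0 then (Fintype.card F : ℂ) ^ finrank F V else 0) -
      if W ≤ LinearMap.ker φ then (Fintype.card F : ℂ) ^ finrank F W else 0 := by
  rw [← sum_addChar_submodule ψ hψ, eq_sub_iff_add_eq, add_comm,
    Finset.sum_filter_add_sum_filter_not]
  split_ifs with h
  · simp only [h, LinearMap.zero_apply, AddChar.map_zero_eq_one, Finset.sum_const, Finset.card_univ,
      nsmul_eq_mul, mul_one]
    rw [Module.card_eq_pow_finrank (K := F) (V := V)]
    push_cast
    rfl
  · exact sum_addChar_linearMap ψ hψ h

open Classical in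
-- Once the last m vectors are fixed, the first one ranges over the complement of their span. The
-- character sum there is the sum over V minus the sum over the span, which has q^m elements and
-- contributes only if `φ 0` kills it.
theorem sum_addChar_linearIndependent_succ (hψ : ψ ≠ 1) {V : Type} [AddCommGroup V] [Module F V]
    [Fintype V] {m : ℕ} (φ : Fin (m + 1) → V →ₗ[F] F) :
    ∑ y : Fin (m + 1) → V with LinearIndependent F y, ψ (∑ i, φ i (y i)) =
      ∑ v : Fin m → V with LinearIndependent F v, ψ (∑ i, φ i.succ (v i)) *
        ((if φ 0 = 0 then (Fintype.card F : ℂ) ^ finrank F V else 0) -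
          if ∀ i, φ 0 (v i) = 0 then (Fintype.card F : ℂ) ^ m else 0) := by
  rw [Finset.sum_filter, ← (Fin.consEquiv fun _ => V).sum_comp, Fintype.sum_prod_type_right,
    Finset.sum_filter]
  refine Finset.sum_congr rfl fun v _ => ?_
  have hc : ∀ x, LinearIndependent F (Fin.consEquiv (fun _ => V) (x, v)) ↔
      LinearIndependent F v ∧ x ∉ Submodule.span F (Set.range v) := fun x =>
    linearIndependent_finCons
  simp only [hc]
  by_cases hv : LinearIndependent F v
  · have hs : (∀ i, φ 0 (v i) = 0) ↔ Submodule.span F (Set.range v) ≤ LinearMap.ker (φ 0) := by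
      rw [Submodule.span_le]
      constructor
      · rintro h _ ⟨i, rfl⟩
        exact h i
      · exact fun h i => h ⟨i, rfl⟩
    have hd : finrank F (Submodule.span F (Set.range v)) = m := by
      rw [finrank_span_eq_card hv, Fintype.card_fin]
    rw [if_pos hv]
    simp only [hs]
    have := sum_addChar_compl_submodule ψ hψ (φ 0) (Submodule.span F (Set.range v))
    rw [hd] at this
    rw [← this, Finset.mul_sum, Finset.sum_filter]
    refine Finset.sum_congr rfl fun x _ => ?_
    simp only [Fin.consEquiv_apply, hv, true_and, Fin.sum_univ_succ, Fin.cons_zero, Fin.cons_succ,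
      AddChar.map_add_eq_mul]
    split_ifs
    · rfl
    · rw [mul_comm]
  · rw [if_neg hv]
    refine Finset.sum_eq_zero fun x _ => ?_
    simp [hv]

open Classical in
theorem sum_linearIndependent_ker {V : Type} [AddCommGroup V] [Module F V]
    [Fintype V] {m : ℕ} (φ : V →ₗ[F] F) (f : (Fin m → V) → ℂ) :
    ∑ v : Fin m → V with LinearIndependent F v, (if ∀ i, φ (v i) = 0 then f v else 0) =
      ∑ v : Fin m → LinearMap.ker φ with LinearIndependent F v, f fun i => v i := by
  rw [← Finset.sum_filter]
  symm
  refine Finset.sum_bij (fun v _ i => (v i : V)) ?_ ?_ ?_ ?_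
  · intro v hv
    simp only [Finset.mem_filter, Finset.mem_univ, true_and] at hv ⊢
    exact ⟨hv.map' _ (Submodule.ker_subtype _), fun i => (v i).2⟩
  · intro v _ w _ h
    funext i
    exact Subtype.ext (congrFun h i)
  · intro v hv
    simp only [Finset.mem_filter, Finset.mem_univ, true_and] at hv
    refine ⟨fun i => ⟨v i, hv.2 i⟩, ?_, rfl⟩
    simp only [Finset.mem_filter, Finset.mem_univ, true_and]
    exact LinearIndependent.of_comp (LinearMap.ker φ).subtype hv.1
  · intros
    rfl

open Classical in
/-- The character sum over all linearly independent families of vectors, paired with linear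
functionals of which `r` are independent. -/
theorem sum_addChar_linearIndependent (hψ : ψ ≠ 1) (m : ℕ) :
    ∀ {V : Type} [AddCommGroup V] [Module F V] [Fintype V] (φ : Fin m → V →ₗ[F] F) (r : ℕ),
      finrank F (LinearMap.ker (LinearMap.pi φ)) + r = finrank F V →
      ∑ y : Fin m → V with LinearIndependent F y, ψ (∑ i, φ i (y i)) =
        (-1) ^ r * (Fintype.card F : ℂ) ^ r.choose 2 *
          ∏ i ∈ Finset.Ico r m, ((Fintype.card F : ℂ) ^ finrank F V - (Fintype.card F : ℂ) ^ i) := by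
  induction m with
  | zero =>
    intro V _ _ _ φ r h
    have hk : LinearMap.ker (LinearMap.pi φ) = ⊤ :=
      LinearMap.ker_eq_top.2 (Subsingleton.elim _ _)
    rw [hk, finrank_top] at h
    obtain rfl : r = 0 := by omega
    simp
  | succ m ih =>
    intro V _ _ _ φ r h
    rw [sum_addChar_linearIndependent_succ ψ hψ]
    have hker : ∀ v, v ∈ LinearMap.ker (LinearMap.pi φ) ↔
        φ 0 v = 0 ∧ ∀ i : Fin m, φ i.succ v = 0 := by
      intro v
      rw [LinearMap.mem_ker, funext_iff, Fin.forall_fin_succ]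
      rfl
    have hrm : r ≤ m + 1 := by
      have h1 := LinearMap.finrank_range_add_finrank_ker (LinearMap.pi φ)
      have h2 := Submodule.finrank_le (LinearMap.range (LinearMap.pi φ))
      rw [finrank_fin_fun] at h2
      omega
    -- If `φ 0` vanishes, r is unchanged and the product gains its top factor. Otherwise only
    -- families inside the hyperplane `ker (φ 0)` survive, and both the dimension and r drop by one.
    by_cases h0 : φ 0 = 0
    · have hk : LinearMap.ker (LinearMap.pi φ) =
          LinearMap.ker (LinearMap.pi fun i : Fin m => φ i.succ) := by
        ext v
        rw [hker, LinearMap.mem_ker, funext_iff]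
        simp [h0]
      have hrm' : r ≤ m := by
        rw [hk] at h
        have h1 := LinearMap.finrank_range_add_finrank_ker
          (LinearMap.pi fun i : Fin m => φ i.succ)
        have h2 := Submodule.finrank_le
          (LinearMap.range (LinearMap.pi fun i : Fin m => φ i.succ))
        rw [finrank_fin_fun] at h2
        omega
      rw [hk] at h
      simp only [h0, LinearMap.zero_apply, implies_true, if_true]
      rw [← Finset.sum_mul, ih _ r h, Finset.prod_Ico_succ_top hrm']
      ring
    · simp only [h0, if_false, zero_sub, mul_neg, mul_ite, mul_zero, Finset.sum_neg_distrib]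
      rw [sum_linearIndependent_ker (φ 0)
        fun v => ψ (∑ i, φ i.succ (v i)) * (Fintype.card F : ℂ) ^ m, ← Finset.sum_mul]
      have hN : finrank F (LinearMap.ker (φ 0)) + 1 = finrank F V := by
        have h1 := LinearMap.finrank_range_add_finrank_ker (φ 0)
        rw [LinearMap.range_eq_top.2 (LinearMap.surjective h0), finrank_top, finrank_self] at h1
        omega
      set φ' : Fin m → LinearMap.ker (φ 0) →ₗ[F] F := fun i => (φ i.succ).domRestrict _ with hφ'
      have hk : finrank F (LinearMap.ker (LinearMap.pi φ')) =
          finrank F (LinearMap.ker (LinearMap.pi φ)) := by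
        rw [← Submodule.finrank_map_subtype_eq]
        congr 2
        all_goals
          ext v
          rw [hker, Submodule.mem_map]
          constructor
          · rintro ⟨⟨w, hw⟩, hw', rfl⟩
            exact ⟨hw, fun i => congrFun hw' i⟩
          · rintro ⟨h1, h2⟩
            exact ⟨⟨v, h1⟩, funext h2, rfl⟩
      have hle : finrank F (LinearMap.ker (LinearMap.pi φ')) ≤ finrank F (LinearMap.ker (φ 0)) :=
        Submodule.finrank_le _
      obtain ⟨r', rfl⟩ : ∃ r', r = r' + 1 := ⟨r - 1, by omega⟩
      have := ih φ' r' (by omega)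
      simp only [hφ', LinearMap.domRestrict_apply] at this
      rw [this, ← hN, ← Finset.prod_Ico_add' (fun i => ((Fintype.card F : ℂ) ^
        (finrank F (LinearMap.ker (φ 0)) + 1) - (Fintype.card F : ℂ) ^ i)) r' m 1]
      have hm : (Fintype.card F : ℂ) ^ m =
          -- The factor q^r' raises the binomial exponent to `(r' + 1).choose 2`, and q^(m - r')
          -- supplies one q to each factor of the shifted product.
          (Fintype.card F : ℂ) ^ r' * (Fintype.card F : ℂ) ^ (m - r') := by
        rw [← pow_add]
        congr 1
        omega
      have hp : ∏ i ∈ Finset.Ico r' m, ((Fintype.card F : ℂ) ^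
          (finrank F (LinearMap.ker (φ 0)) + 1) - (Fintype.card F : ℂ) ^ (i + 1)) =
          (Fintype.card F : ℂ) ^ (m - r') * ∏ i ∈ Finset.Ico r' m, ((Fintype.card F : ℂ) ^
          (finrank F (LinearMap.ker (φ 0))) - (Fintype.card F : ℂ) ^ i) := by
        rw [← Nat.card_Ico, ← Finset.prod_const, ← Finset.prod_mul_distrib]
        refine Finset.prod_congr rfl fun i _ => ?_
        ring
      rw [hp, hm, Nat.choose_succ_succ' r' 1, Nat.choose_one_right, pow_add _ r']
      ring

end CharacterSums

/-! ### Fourier analysis on matrices and the rectangle bound. -/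

section Pairing

set_option linter.unusedSectionVars false

open Matrix

variable {F : Type} [Field F] [Fintype F] {m n : ℕ}

/-- The entrywise bilinear pairing of matrices. -/
def entryPairing (y z : Matrix (Fin m) (Fin n) F) : F := ∑ i, ∑ j, z i j * y i j

theorem entryPairing_add (y z z' : Matrix (Fin m) (Fin n) F) :
    entryPairing y (z + z') = entryPairing y z + entryPairing y z' := by
  simp [entryPairing, add_mul, Finset.sum_add_distrib]

theorem entryPairing_sub (y z z' : Matrix (Fin m) (Fin n) F) :
    entryPairing y (z - z') = entryPairing y z - entryPairing y z' := by
  simp [entryPairing, sub_mul, Finset.sum_sub_distrib]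

theorem sum_addChar_entryPairing [DecidableEq F] {ψ : AddChar F ℂ} (hψ : ψ ≠ 1)
    (z : Matrix (Fin m) (Fin n) F) :
    ∑ y, ψ (entryPairing y z) = if z = 0 then (Fintype.card (Matrix (Fin m) (Fin n) F) : ℂ) else 0 := by
  split_ifs with h
  · simp [h, entryPairing]
  · let φ : Matrix (Fin m) (Fin n) F →ₗ[F] F :=
      { toFun := fun y => entryPairing y z
        map_add' := fun y y' => by simp [entryPairing, mul_add, Finset.sum_add_distrib]
        map_smul' := fun c y => by
          simp only [entryPairing, Matrix.smul_apply, smul_eq_mul, RingHom.id_apply, Finset.mul_sum]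
          exact Finset.sum_congr rfl fun i _ => Finset.sum_congr rfl fun j _ => by ring }
    refine sum_addChar_linearMap ψ hψ (φ := φ) fun h0 => h ?_
    ext i j
    have := LinearMap.congr_fun h0 (Matrix.single i j 1)
    simpa [φ, entryPairing, Matrix.single, ite_and] using this

/-- Parseval's identity for the indicator function of a set of matrices. -/
theorem sum_norm_sq_fourier {ψ : AddChar F ℂ} (hψ : ψ ≠ 1)
    (S : Finset (Matrix (Fin m) (Fin n) F)) :
    ∑ y, ‖∑ x ∈ S, ψ (entryPairing y x)‖ ^ 2 =
      (Fintype.card (Matrix (Fin m) (Fin n) F) : ℝ) * S.card := by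
  classical
  have key : ∀ y : Matrix (Fin m) (Fin n) F, ((‖∑ x ∈ S, ψ (entryPairing y x)‖ ^ 2 : ℝ) : ℂ) =
      ∑ x ∈ S, ∑ x' ∈ S, ψ (entryPairing y (x - x')) := by
    intro y
    push_cast
    rw [← Complex.mul_conj', map_sum, Finset.sum_mul_sum]
    refine Finset.sum_congr rfl fun x _ => Finset.sum_congr rfl fun x' _ => ?_
    rw [entryPairing_sub, sub_eq_add_neg, AddChar.map_add_eq_mul, AddChar.map_neg_eq_conj]
  apply Complex.ofReal_injective
  rw [Complex.ofReal_sum]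
  simp only [key]
  rw [Finset.sum_comm]
  have : ∀ x ∈ S, ∑ y, ∑ x' ∈ S, ψ (entryPairing y (x - x')) =
      (Fintype.card (Matrix (Fin m) (Fin n) F) : ℂ) := by
    intro x hx
    rw [Finset.sum_comm]
    simp only [sum_addChar_entryPairing hψ, sub_eq_zero]
    rw [Finset.sum_ite_eq, if_pos hx]
  rw [Finset.sum_congr rfl this]
  simp [mul_comm]

/-- A function whose Fourier transform is the indicator of a set of matrices has small
correlation with all rectangles. -/
theorem rectangleBound_of_fourier {ψ : AddChar F ℂ} (hψ : ψ ≠ 1)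
    {g : Matrix (Fin m) (Fin n) F → ℝ} (Y : Finset (Matrix (Fin m) (Fin n) F))
    (hg : ∀ z, (g z : ℂ) = ∑ y ∈ Y, ψ (entryPairing y z)) :
    RectangleBound g ((Fintype.card (Matrix (Fin m) (Fin n) F) : ℝ) ^ 2) := by
  classical
  intro S T
  set C : ℝ := (Fintype.card (Matrix (Fin m) (Fin n) F) : ℝ) with hC
  set a : Matrix (Fin m) (Fin n) F → ℝ := fun y => ‖∑ x ∈ S, ψ (entryPairing y x)‖
  set b : Matrix (Fin m) (Fin n) F → ℝ := fun y => ‖∑ x ∈ T, ψ (entryPairing y x)‖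
  -- At each frequency the character of x + x' splits, so the sum over the rectangle is a product of
  -- two Fourier coefficients.
  have h1 : ((∑ x ∈ S, ∑ y ∈ T, g (x + y) : ℝ) : ℂ) =
      ∑ y ∈ Y, (∑ x ∈ S, ψ (entryPairing y x)) * ∑ x ∈ T, ψ (entryPairing y x) := by
    push_cast
    simp only [hg, Finset.sum_mul_sum]
    rw [Finset.sum_comm (s := Y)]
    refine Finset.sum_congr rfl fun x _ => ?_
    rw [Finset.sum_comm (s := Y)]
    refine Finset.sum_congr rfl fun x' _ => Finset.sum_congr rfl fun y _ => ?_
    rw [entryPairing_add, AddChar.map_add_eq_mul]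
  have hle : ∀ S : Finset (Matrix (Fin m) (Fin n) F), (S.card : ℝ) ≤ C := fun S => by
    rw [hC]
    exact_mod_cast Finset.card_le_univ S
  have h2 : |∑ x ∈ S, ∑ y ∈ T, g (x + y)| ≤ ∑ y, a y * b y := by
    rw [← Real.norm_eq_abs, ← Complex.norm_real, h1]
    refine (norm_sum_le _ _).trans ?_
    simp only [norm_mul]
    exact Finset.sum_le_univ_sum_of_nonneg fun y => mul_nonneg (norm_nonneg _) (norm_nonneg _)
  have ha : ∑ y, a y ^ 2 ≤ C ^ 2 := by
    rw [sum_norm_sq_fourier hψ, sq]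
    exact mul_le_mul_of_nonneg_left (hle S) (Nat.cast_nonneg _)
  have hb : ∑ y, b y ^ 2 ≤ C ^ 2 := by
    rw [sum_norm_sq_fourier hψ, sq]
    exact mul_le_mul_of_nonneg_left (hle T) (Nat.cast_nonneg _)
  have h3 : ∑ y, a y * b y ≤ ∑ y, (a y ^ 2 + b y ^ 2) / 2 :=
    Finset.sum_le_sum fun y _ => by nlinarith [sq_nonneg (a y - b y)]
  rw [← Finset.sum_div, Finset.sum_add_distrib] at h3
  linarith

end Pairing

/-! ### Frame counts and q-factorials. -/

/-- `∏_{i < m} (q ^ d - q ^ i)`, the number of linearly independent families of `m` vectors in a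
space of dimension `d` over a field with `q` elements. -/
noncomputable def frameCount (q : ℝ) (m d : ℕ) : ℝ := ∏ i ∈ Finset.range m, (q ^ d - q ^ i)

/-- `∏_{i = 1}^{t} (q ^ i - 1)`. -/
noncomputable def qFactorial (q : ℝ) (t : ℕ) : ℝ := ∏ i ∈ Finset.range t, (q ^ (i + 1) - 1)

section FrameCount

variable {q : ℝ}

theorem frameCount_eq_zero {m d : ℕ} (h : d < m) : frameCount q m d = 0 :=
  Finset.prod_eq_zero (Finset.mem_range.2 h) (sub_self _)

theorem frameCount_nonneg (hq : 1 ≤ q) (m d : ℕ) : 0 ≤ frameCount q m d := by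
  rcases lt_or_ge d m with h | h
  · rw [frameCount_eq_zero h]
  · refine Finset.prod_nonneg fun i hi => sub_nonneg.2 ?_
    exact pow_le_pow_right₀ hq ((Finset.mem_range.1 hi).le.trans h)

theorem frameCount_mono (hq : 1 ≤ q) (m : ℕ) {d d' : ℕ} (h : d ≤ d') :
    frameCount q m d ≤ frameCount q m d' := by
  rcases lt_or_ge d m with hd | hd
  · rw [frameCount_eq_zero hd]
    exact frameCount_nonneg hq m d'
  · refine Finset.prod_le_prod (fun i hi => sub_nonneg.2 ?_) fun i _ => ?_
    · exact pow_le_pow_right₀ hq ((Finset.mem_range.1 hi).le.trans hd)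
    · gcongr

theorem frameCount_le (hq : 1 ≤ q) (m d : ℕ) : frameCount q m d ≤ q ^ (d * m) := by
  rcases lt_or_ge d m with hd | hd
  · rw [frameCount_eq_zero hd]
    positivity
  · rw [pow_mul]
    conv_rhs => rw [← Finset.card_range m, ← Finset.prod_const]
    refine Finset.prod_le_prod (fun i hi => sub_nonneg.2 ?_) fun i _ => ?_
    · exact pow_le_pow_right₀ hq ((Finset.mem_range.1 hi).le.trans hd)
    · exact sub_le_self _ (by positivity)

theorem qFactorial_nonneg (hq : 1 ≤ q) (t : ℕ) : 0 ≤ qFactorial q t :=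
  Finset.prod_nonneg fun _ _ => sub_nonneg.2 (one_le_pow₀ hq)

theorem qFactorial_pos (hq : 1 < q) (t : ℕ) : 0 < qFactorial q t :=
  Finset.prod_pos fun i _ => sub_pos.2 (one_lt_pow₀ hq i.succ_ne_zero)

theorem qFactorial_succ (t : ℕ) : qFactorial q (t + 1) = qFactorial q t * (q ^ (t + 1) - 1) :=
  Finset.prod_range_succ _ _

/-- Pulling q^i out of factor i leaves q^j - 1 for j = 1, …, t, and the extracted powers complete
the exponent to `(r + t).choose 2`. This rewrites the character sum, given by the rank r, in terms
of the corank t. -/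
theorem pow_choose_mul_prod_Ico (t : ℕ) : ∀ r : ℕ,
    q ^ r.choose 2 * ∏ i ∈ Finset.Ico r (r + t), (q ^ (r + t) - q ^ i) =
      q ^ (r + t).choose 2 * qFactorial q t := by
  induction t with
  | zero => simp [qFactorial]
  | succ t ih =>
    intro r
    have := ih (r + 1)
    rw [show r + 1 + t = r + (t + 1) by ring, Nat.choose_succ_succ' r 1, Nat.choose_one_right] at this
    rw [Finset.prod_eq_prod_Ico_succ_bot (by omega), qFactorial_succ, ← mul_assoc _ (qFactorial q t),
      ← this, pow_add q r (r.choose _),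
      show q ^ (r + (t + 1)) - q ^ r = q ^ r * (q ^ (t + 1) - 1) by rw [pow_add]; ring]
    ring

theorem frameCount_self (t : ℕ) : frameCount q t t = q ^ t.choose 2 * qFactorial q t := by
  have := pow_choose_mul_prod_Ico (q := q) t 0
  simpa [frameCount] using this

end FrameCount

/-! ### Counting matrices by corank through moments of kernel frames. -/

section Counting

set_option linter.unusedSectionVars false

open Module Matrix

variable {F : Type} [Field F] [Fintype F]

open Classical in
theorem card_linearIndependent_mem {V : Type} [AddCommGroup V] [Module F V] [Fintype V]
    (W : Submodule F V) (m : ℕ) :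
    (({v : Fin m → V | LinearIndependent F v ∧ ∀ j, v j ∈ W} : Finset _).card : ℝ) =
      frameCount (Fintype.card F) m (finrank F W) := by
  have h1 : ({v : Fin m → V | LinearIndependent F v ∧ ∀ j, v j ∈ W} : Finset _).card =
      Nat.card {s : Fin m → W // LinearIndependent F s} := by
    rw [Nat.card_eq_fintype_card, Fintype.card_subtype]
    symm
    refine Finset.card_bij (fun v _ i => (v i : V)) ?_ ?_ ?_
    · intro v hv
      simp only [Finset.mem_filter, Finset.mem_univ, true_and] at hv ⊢
      exact ⟨hv.map' _ (Submodule.ker_subtype _), fun i => (v i).2⟩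
    · intro v _ w _ h
      funext i
      exact Subtype.ext (congrFun h i)
    · intro v hv
      simp only [Finset.mem_filter, Finset.mem_univ, true_and] at hv
      refine ⟨fun i => ⟨v i, hv.2 i⟩, ?_, rfl⟩
      simp only [Finset.mem_filter, Finset.mem_univ, true_and]
      exact LinearIndependent.of_comp W.subtype hv.1
  rw [h1]
  rcases lt_or_ge (finrank F W) m with h | h
  · rw [frameCount_eq_zero h]
    have : IsEmpty {s : Fin m → W // LinearIndependent F s} := ⟨fun s => by
      have := s.2.fintype_card_le_finrank
      rw [Fintype.card_fin] at this
      omega⟩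
    simp
  · rw [card_linearIndependent h, frameCount, ← Fin.prod_univ_eq_prod_range
      (fun i => (Fintype.card F : ℝ) ^ finrank F W - (Fintype.card F : ℝ) ^ i)]
    push_cast
    refine Finset.prod_congr rfl fun i _ => ?_
    rw [Nat.cast_sub (Nat.pow_le_pow_right Fintype.card_pos (i.2.le.trans h))]
    push_cast
    rfl

open Classical in
theorem card_orthogonal {n m : ℕ} {v : Fin m → Fin n → F} (hv : LinearIndependent F v) :
    (({r : Fin n → F | ∀ j, r ⬝ᵥ v j = 0} : Finset _).card : ℝ) * (Fintype.card F : ℝ) ^ m =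
      (Fintype.card F : ℝ) ^ n := by
  have hker : ({r : Fin n → F | ∀ j, r ⬝ᵥ v j = 0} : Finset _).card =
      Fintype.card (LinearMap.ker (Matrix.of v).mulVecLin) := by
    rw [Fintype.card_subtype]
    congr 1
    ext r
    simp only [Finset.mem_filter, Finset.mem_univ, true_and, LinearMap.mem_ker, mulVecLin_apply,
      funext_iff]
    refine forall_congr' fun j => ?_
    rw [dotProduct_comm]
    rfl
  have hrank : (Matrix.of v).rank = m := by
    have := LinearIndependent.rank_matrix (M := Matrix.of v) hv
    simpa using this
  have := LinearMap.finrank_range_add_finrank_ker (Matrix.of v).mulVecLin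
  rw [← Matrix.rank, hrank, finrank_fin_fun] at this
  rw [hker, Module.card_eq_pow_finrank (K := F)]
  push_cast
  rw [← pow_add, add_comm, this]

/-- The dimension of the kernel of a matrix. -/
noncomputable def corank {m n : ℕ} (z : Matrix (Fin m) (Fin n) F) : ℕ :=
  finrank F (LinearMap.ker z.mulVecLin)

theorem rank_add_corank {m n : ℕ} (z : Matrix (Fin m) (Fin n) F) : z.rank + corank z = n := by
  have := LinearMap.finrank_range_add_finrank_ker z.mulVecLin
  rwa [finrank_fin_fun] at this

theorem corank_le {m n : ℕ} (z : Matrix (Fin m) (Fin n) F) : corank z ≤ n := by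
  have := rank_add_corank z
  omega

theorem corank_eq_zero_iff_injective {m n : ℕ} {z : Matrix (Fin m) (Fin n) F} :
    corank z = 0 ↔ Function.Injective z.mulVec := by
  rw [corank, Submodule.finrank_eq_zero, LinearMap.ker_eq_bot, coe_mulVecLin]

theorem corank_eq_zero_iff_isUnit {n : ℕ} {z : Matrix (Fin n) (Fin n) F} :
    corank z = 0 ↔ IsUnit z := by
  rw [corank_eq_zero_iff_injective, mulVec_injective_iff_isUnit]

/-- Put a row on top of a matrix. -/
def consRow {m n : ℕ} (r : Fin n → F) (z : Matrix (Fin m) (Fin n) F) :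
    Matrix (Fin (m + 1)) (Fin n) F :=
  Matrix.of (Fin.cons r z : Fin (m + 1) → Fin n → F)

/-- Put a column on the left of a matrix. -/
def consCol {m n : ℕ} (v : Fin m → F) (z : Matrix (Fin m) (Fin n) F) :
    Matrix (Fin m) (Fin (n + 1)) F :=
  Matrix.of fun i => Fin.cons (v i) (z i)

theorem sum_consRow {m n : ℕ} (f : Matrix (Fin (m + 1)) (Fin n) F → ℝ) :
    ∑ z, f z = ∑ z : Matrix (Fin m) (Fin n) F, ∑ r, f (consRow r z) := by
  rw [← Fintype.sum_prod_type_right (fun x : (Fin n → F) × Matrix (Fin m) (Fin n) F =>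
    f (consRow x.1 x.2))]
  exact ((Fin.consEquiv fun _ => Fin n → F).sum_comp (fun z => f (Matrix.of z))).symm

theorem sum_consCol {m n : ℕ} (f : Matrix (Fin m) (Fin (n + 1)) F → ℝ) :
    ∑ z, f z = ∑ z : Matrix (Fin m) (Fin n) F, ∑ v, f (consCol v z) := by
  rw [← Fintype.sum_prod_type_right (fun x : (Fin m → F) × Matrix (Fin m) (Fin n) F =>
    f (consCol x.1 x.2))]
  symm
  let e : (Fin m → F) × Matrix (Fin m) (Fin n) F ≃ Matrix (Fin m) (Fin (n + 1)) F :=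
    { toFun := fun x => consCol x.1 x.2
      invFun := fun z => (fun i => z i 0, Matrix.of fun i j => z i j.succ)
      left_inv := fun x => rfl
      right_inv := fun z => by
        ext i j
        refine Fin.cases ?_ (fun j => ?_) j <;> rfl }
  exact e.sum_comp f

theorem mem_ker_consRow {m n : ℕ} (r : Fin n → F) (z : Matrix (Fin m) (Fin n) F) (x : Fin n → F) :
    x ∈ LinearMap.ker (consRow r z).mulVecLin ↔
      x ∈ LinearMap.ker z.mulVecLin ∧ r ⬝ᵥ x = 0 := by
  simp only [LinearMap.mem_ker, mulVecLin_apply, funext_iff, Fin.forall_fin_succ]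
  exact and_comm

/-- Double counting: an independent k-family in the kernel of `z` stays in the kernel after a row r
is added exactly when r is orthogonal to it, which holds for a fraction q^(-k) of all rows. -/
theorem sum_frameCount_corank_consRow {m n : ℕ} (z : Matrix (Fin m) (Fin n) F) (k : ℕ) :
    (∑ r, frameCount (Fintype.card F) k (corank (consRow r z))) * (Fintype.card F : ℝ) ^ k =
      frameCount (Fintype.card F) k (corank z) * (Fintype.card F : ℝ) ^ n := by
  classical
  have h1 : ∀ r, frameCount (Fintype.card F) k (corank (consRow r z)) =
      ∑ v : Fin k → Fin n → F,
        if LinearIndependent F v ∧ ∀ j, v j ∈ LinearMap.ker z.mulVecLin then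
          (if ∀ j, r ⬝ᵥ v j = 0 then (1 : ℝ) else 0) else 0 := by
    intro r
    rw [corank, ← card_linearIndependent_mem, Finset.card_filter]
    push_cast
    refine Finset.sum_congr rfl fun v _ => ?_
    rw [← ite_and]
    refine if_congr ?_ rfl rfl
    simp only [mem_ker_consRow, forall_and, and_assoc]
  simp only [h1]
  rw [Finset.sum_comm, corank, ← card_linearIndependent_mem, Finset.card_filter]
  push_cast
  rw [Finset.sum_mul, Finset.sum_mul]
  refine Finset.sum_congr rfl fun v _ => ?_
  split_ifs with h
  · have := card_orthogonal h.1
    rw [Finset.card_filter] at this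
    push_cast at this
    rw [this, one_mul]
  · simp

/-- This is the k-th factorial moment of the kernel: each of the m rows independently keeps a fixed
k-frame with probability q^(-k). -/
theorem sum_frameCount_corank (m n k : ℕ) :
    (∑ z : Matrix (Fin m) (Fin n) F, frameCount (Fintype.card F) k (corank z)) *
      (Fintype.card F : ℝ) ^ (m * k) =
      frameCount (Fintype.card F) k n * (Fintype.card F : ℝ) ^ (m * n) := by
  induction m with
  | zero =>
    have : ∀ z : Matrix (Fin 0) (Fin n) F, corank z = n := fun z => by
      have h1 := rank_add_corank z
      have h2 := z.rank_le_height
      omega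
    have hcard : Fintype.card (Matrix (Fin 0) (Fin n) F) = 1 :=
      Fintype.card_eq_one_iff.2 ⟨0, fun z => Subsingleton.elim _ _⟩
    simp only [this, zero_mul, pow_zero, mul_one, Finset.sum_const, nsmul_eq_mul, Finset.card_univ,
      hcard, Nat.cast_one, one_mul]
  | succ m ih =>
    rw [sum_consRow]
    have h : ∀ z : Matrix (Fin m) (Fin n) F,
        (∑ r, frameCount (Fintype.card F) k (corank (consRow r z))) *
          (Fintype.card F : ℝ) ^ ((m + 1) * k) =
        frameCount (Fintype.card F) k (corank z) * (Fintype.card F : ℝ) ^ (m * k) *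
          (Fintype.card F : ℝ) ^ n := by
      intro z
      rw [show (Fintype.card F : ℝ) ^ ((m + 1) * k) =
        (Fintype.card F : ℝ) ^ k * (Fintype.card F : ℝ) ^ (m * k) by ring, ← mul_assoc,
        sum_frameCount_corank_consRow]
      ring
    rw [Finset.sum_mul, Finset.sum_congr rfl fun z _ => h z, ← Finset.sum_mul, ← Finset.sum_mul, ih]
    ring

open Classical in
-- Markov's inequality for the t-th moment: every matrix of corank t contributes `frameCount t t` to
-- it.
theorem card_corank_mul_le (n t : ℕ) :
    (({z : Matrix (Fin n) (Fin n) F | corank z = t} : Finset _).card : ℝ) *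
      frameCount (Fintype.card F) t t ≤ (Fintype.card F : ℝ) ^ (n * n) := by
  have hq : (1 : ℝ) ≤ Fintype.card F := by exact_mod_cast Fintype.card_pos
  have h1 := sum_frameCount_corank (F := F) n n t
  have h2 := frameCount_le hq t n
  have h3 : (({z : Matrix (Fin n) (Fin n) F | corank z = t} : Finset _).card : ℝ) *
      frameCount (Fintype.card F) t t ≤
      ∑ z : Matrix (Fin n) (Fin n) F, frameCount (Fintype.card F) t (corank z) := by
    rw [← nsmul_eq_mul, ← Finset.sum_const]
    refine le_trans (le_of_eq (Finset.sum_congr rfl fun z hz => ?_))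
      (Finset.sum_le_univ_sum_of_nonneg fun z => frameCount_nonneg hq _ _)
    rw [(Finset.mem_filter.1 hz).2]
  have h4 : (0 : ℝ) < (Fintype.card F : ℝ) ^ (n * t) := by positivity
  refine h3.trans (le_of_mul_le_mul_right ?_ h4)
  rw [h1, mul_comm]
  gcongr

open Classical in
theorem card_corank_eq_zero (n : ℕ) :
    (({z : Matrix (Fin n) (Fin n) F | corank z = 0} : Finset _).card : ℝ) =
      frameCount (Fintype.card F) n n := by
  have := card_linearIndependent_mem (F := F) (⊤ : Submodule F (Fin n → F)) n
  rw [finrank_top, finrank_fin_fun] at this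
  rw [← this]
  congr 1
  refine Finset.card_bij (fun z _ => z.col) ?_ ?_ ?_
  · intro z hz
    exact Finset.mem_filter.2 ⟨Finset.mem_univ _, mulVec_injective_iff.1
      (corank_eq_zero_iff_injective.1 (Finset.mem_filter.1 hz).2), fun _ => Submodule.mem_top⟩
  · intro z _ z' _ h
    exact transpose_injective h
  · intro v hv
    refine ⟨(Matrix.of v)ᵀ, ?_, rfl⟩
    exact Finset.mem_filter.2 ⟨Finset.mem_univ _, corank_eq_zero_iff_injective.2
      (mulVec_injective_iff.2 (Finset.mem_filter.1 hv).2.1)⟩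

theorem consCol_mulVec {m n : ℕ} (v : Fin m → F) (z : Matrix (Fin m) (Fin n) F)
    (x : Fin (n + 1) → F) : consCol v z *ᵥ x = x 0 • v + z *ᵥ Fin.tail x := by
  ext i
  simp [consCol, mulVec, dotProduct, Fin.sum_univ_succ, Fin.tail, mul_comm]

/-- A kernel vector with nonzero first coordinate would express `v` through the columns of `z`, so
the new kernel embeds into the old one. -/
theorem corank_consCol_of_notMem {m n : ℕ} {v : Fin m → F} {z : Matrix (Fin m) (Fin n) F}
    (hv : v ∉ LinearMap.range z.mulVecLin) : corank (consCol v z) ≤ corank z := by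
  have h0 : ∀ x ∈ LinearMap.ker (consCol v z).mulVecLin, x 0 = 0 ∧ z *ᵥ Fin.tail x = 0 := by
    intro x hx
    rw [LinearMap.mem_ker, mulVecLin_apply, consCol_mulVec] at hx
    by_cases hx0 : x 0 = 0
    · rw [hx0, zero_smul, zero_add] at hx
      exact ⟨hx0, hx⟩
    · refine absurd ⟨-((x 0)⁻¹ • Fin.tail x), ?_⟩ hv
      rw [mulVecLin_apply, mulVec_neg, mulVec_smul, eq_neg_of_add_eq_zero_right hx, smul_neg,
        neg_neg, inv_smul_smul₀ hx0]
  let f : LinearMap.ker (consCol v z).mulVecLin →ₗ[F] LinearMap.ker z.mulVecLin :=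
    { toFun := fun x => ⟨Fin.tail x.1, (h0 x.1 x.2).2⟩
      map_add' := fun _ _ => rfl
      map_smul' := fun _ _ => rfl }
  refine LinearMap.finrank_le_finrank_of_injective (f := f) fun x y h => Subtype.ext ?_
  rw [← Fin.cons_self_tail x.1, ← Fin.cons_self_tail y.1, (h0 _ x.2).1, (h0 _ y.2).1]
  exact congrArg _ (Subtype.ext_iff.1 h)

theorem corank_consCol_le {m n : ℕ} (v : Fin m → F) (z : Matrix (Fin m) (Fin n) F) :
    corank (consCol v z) ≤ corank z + 1 := by
  let f : LinearMap.ker (consCol v z).mulVecLin →ₗ[F] F :=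
    (LinearMap.proj 0).domRestrict _
  have h1 := LinearMap.finrank_range_add_finrank_ker f
  have h2 : finrank F (LinearMap.range f) ≤ 1 := by
    simpa using Submodule.finrank_le (LinearMap.range f)
  have h3 : finrank F (LinearMap.ker f) ≤ corank z := by
    have h0 : ∀ x : LinearMap.ker f, z *ᵥ Fin.tail x.1.1 = 0 := fun x => by
      have hx := x.1.2
      have hx0 : x.1.1 0 = 0 := x.2
      rw [LinearMap.mem_ker, mulVecLin_apply, consCol_mulVec, hx0, zero_smul, zero_add] at hx
      exact hx
    let g : LinearMap.ker f →ₗ[F] LinearMap.ker z.mulVecLin :=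
      { toFun := fun x => ⟨Fin.tail x.1.1, h0 x⟩
        map_add' := fun _ _ => rfl
        map_smul' := fun _ _ => rfl }
    refine LinearMap.finrank_le_finrank_of_injective (f := g)
      fun x y h => Subtype.ext (Subtype.ext ?_)
    have hx0 : x.1.1 0 = 0 := x.2
    have hy0 : y.1.1 0 = 0 := y.2
    rw [← Fin.cons_self_tail x.1.1, ← Fin.cons_self_tail y.1.1, hx0, hy0]
    exact congrArg _ (Subtype.ext_iff.1 h)
  unfold corank at *
  omega

/-- The corank can grow only if the new column lies in the column space of `w`, which happens for a
fraction q^(-corank w) of all columns, and then it grows by at most one. -/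
theorem sum_frameCount_corank_consCol_le {n : ℕ} (w : Matrix (Fin n) (Fin n) F) (k : ℕ) :
    (∑ v, frameCount (Fintype.card F) k (corank (consCol v w))) *
        (Fintype.card F : ℝ) ^ corank w ≤
      (Fintype.card F : ℝ) ^ n * ((Fintype.card F : ℝ) ^ corank w *
        frameCount (Fintype.card F) k (corank w) +
        frameCount (Fintype.card F) k (corank w + 1)) := by
  classical
  have hq : (1 : ℝ) ≤ Fintype.card F := by exact_mod_cast Fintype.card_pos
  have h1 : ∑ v, frameCount (Fintype.card F) k (corank (consCol v w)) ≤
      ∑ v : Fin n → F, (frameCount (Fintype.card F) k (corank w) +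
        if v ∈ LinearMap.range w.mulVecLin then frameCount (Fintype.card F) k (corank w + 1)
        else 0) := by
    refine Finset.sum_le_sum fun v _ => ?_
    split_ifs with hv
    · exact (frameCount_mono hq k (corank_consCol_le v w)).trans
        (le_add_of_nonneg_left (frameCount_nonneg hq _ _))
    · rw [add_zero]
      exact frameCount_mono hq k (corank_consCol_of_notMem hv)
  have h2 : (({v : Fin n → F | v ∈ LinearMap.range w.mulVecLin} : Finset _).card : ℝ) =
      (Fintype.card F : ℝ) ^ w.rank := by
    rw [← Fintype.card_subtype, Module.card_eq_pow_finrank (K := F)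
      (V := LinearMap.range w.mulVecLin)]
    push_cast
    rfl
  rw [Finset.sum_add_distrib, Finset.sum_const, ← Finset.sum_filter, Finset.sum_const,
    nsmul_eq_mul, nsmul_eq_mul, h2, Finset.card_univ, Fintype.card_fun, Fintype.card_fin] at h1
  push_cast at h1
  refine (mul_le_mul_of_nonneg_right h1 (by positivity)).trans (le_of_eq ?_)
  have h3 : (Fintype.card F : ℝ) ^ n =
      (Fintype.card F : ℝ) ^ w.rank * (Fintype.card F : ℝ) ^ corank w := by
    rw [← pow_add, rank_add_corank]
  rw [add_mul, mul_add, h3]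
  ring

/-- The square matrices that extend a given one by a row and a column, weighted by the number of
linearly independent families in the kernel. -/
theorem sum_frameCount_corank_extend_le {n : ℕ} (w : Matrix (Fin n) (Fin n) F) (k : ℕ) :
    (∑ v, ∑ r, frameCount (Fintype.card F) k (corank (consRow r (consCol v w)))) *
        ((Fintype.card F : ℝ) ^ k * (Fintype.card F : ℝ) ^ corank w) ≤
      (Fintype.card F : ℝ) ^ (2 * n + 1) * ((Fintype.card F : ℝ) ^ corank w *
        frameCount (Fintype.card F) k (corank w) +
        frameCount (Fintype.card F) k (corank w + 1)) := by
  rw [← mul_assoc, Finset.sum_mul,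
    Finset.sum_congr rfl fun v _ => sum_frameCount_corank_consRow (consCol v w) k,
    ← Finset.sum_mul, mul_right_comm]
  refine (mul_le_mul_of_nonneg_right (sum_frameCount_corank_consCol_le w k)
    (by positivity)).trans (le_of_eq ?_)
  ring

end Counting

/-! ### The witnesses, their rectangle bounds and the corank sieve. -/

section Witness

set_option linter.unusedSectionVars false

open Module Matrix

/-- The value on matrices of corank `t` of the Fourier transform of the indicator function of the
invertible `N × N` matrices over a field with `q` elements, up to a global sign. -/
noncomputable def rankWitness (q : ℝ) (N t : ℕ) : ℝ := (-1) ^ t * (q ^ N.choose 2 * qFactorial q t)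

theorem abs_rankWitness {q : ℝ} (hq : 1 ≤ q) (N t : ℕ) :
    |rankWitness q N t| = q ^ N.choose 2 * qFactorial q t := by
  have h : 0 ≤ q ^ N.choose 2 * qFactorial q t := mul_nonneg (by positivity) (qFactorial_nonneg hq t)
  rw [rankWitness, abs_mul, abs_pow, abs_neg, abs_one, one_pow, one_mul, abs_of_nonneg h]

theorem rankWitness_of_even {q : ℝ} (hq : 1 ≤ q) {N t : ℕ} (ht : Even t) :
    rankWitness q N t = |rankWitness q N t| := by
  rw [abs_rankWitness hq, rankWitness, ht.neg_one_pow, one_mul]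

theorem rankWitness_of_odd {q : ℝ} (hq : 1 ≤ q) {N t : ℕ} (ht : Odd t) :
    rankWitness q N t = -|rankWitness q N t| := by
  rw [abs_rankWitness hq, rankWitness, ht.neg_one_pow, neg_one_mul]

variable {F : Type} [Field F] [Fintype F]

open Classical in
-- The pairing applies row i of `z` to row i of y. The joint kernel of these functionals is the
-- kernel of `z`, so the general character sum applies with r equal to the rank.
theorem sum_addChar_entryPairing_linearIndependent {ψ : AddChar F ℂ} (hψ : ψ ≠ 1) {N : ℕ}
    (z : Matrix (Fin N) (Fin N) F) :
    (((-1) ^ N * rankWitness (Fintype.card F) N (corank z) : ℝ) : ℂ) =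
      ∑ y : Matrix (Fin N) (Fin N) F with LinearIndependent F y.row, ψ (entryPairing y z) := by
  have h := rank_add_corank z
  have h1 := sum_addChar_linearIndependent ψ hψ N
    (fun i => (LinearMap.proj i : (Fin N → F) →ₗ[F] F) ∘ₗ z.mulVecLin) z.rank
    (by rw [finrank_fin_fun, add_comm]; exact h)
  rw [finrank_fin_fun] at h1
  refine Eq.trans ?_ h1.symm
  have h2 := pow_choose_mul_prod_Ico (q := (Fintype.card F : ℝ)) (corank z) z.rank
  rw [h] at h2
  rw [rankWitness, ← h2]
  have h3 : (-1 : ℝ) ^ (z.rank + corank z) * (-1) ^ corank z = (-1) ^ z.rank := by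
    rw [pow_add, mul_assoc, ← mul_pow]
    simp
  rw [h] at h3
  rw [← mul_assoc, h3]
  push_cast
  ring

theorem RectangleBound.const_mul {G : Type} [Add G] {g : G → ℝ} {B : ℝ} (h : RectangleBound g B)
    (c : ℝ) : RectangleBound (fun z => c * g z) (|c| * B) := by
  intro S T
  simp only [← Finset.mul_sum]
  rw [abs_mul]
  exact mul_le_mul_of_nonneg_left (h S T) (abs_nonneg c)

theorem RectangleBound.sub {G : Type} [Add G] {g g' : G → ℝ} {B B' : ℝ} (h : RectangleBound g B)
    (h' : RectangleBound g' B') : RectangleBound (fun z => g z - g' z) (B + B') := by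
  intro S T
  simp only [Finset.sum_sub_distrib]
  exact (abs_sub _ _).trans (add_le_add (h S T) (h' S T))

theorem RectangleBound.mono {G : Type} [Add G] {g : G → ℝ} {B B' : ℝ} (h : RectangleBound g B)
    (hB : B ≤ B') : RectangleBound g B' := fun S T => (h S T).trans hB

theorem RectangleBound.comp_injective {G H : Type} [AddZeroClass G] [AddZeroClass H] {g : H → ℝ}
    {B : ℝ} (h : RectangleBound g B) (f : G →+ H) (hf : Function.Injective f) :
    RectangleBound (fun z => g (f z)) B := by
  classical
  intro S T
  have := h (S.map ⟨f, hf⟩) (T.map ⟨f, hf⟩)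
  simpa [Finset.sum_map] using this

theorem rectangleBound_rankWitness {ψ : AddChar F ℂ} (hψ : ψ ≠ 1) (N : ℕ) :
    RectangleBound (fun z : Matrix (Fin N) (Fin N) F =>
      rankWitness (Fintype.card F) N (corank z))
      ((Fintype.card (Matrix (Fin N) (Fin N) F) : ℝ) ^ 2) := by
  classical
  have := (rectangleBound_of_fourier hψ _
    (sum_addChar_entryPairing_linearIndependent (N := N) hψ)).const_mul ((-1) ^ N)
  simpa [← mul_assoc, ← mul_pow] using this

/-- The matrix without its first row and its first column. -/
def minorMatrix {N : ℕ} (z : Matrix (Fin (N + 1)) (Fin (N + 1)) F) : Matrix (Fin N) (Fin N) F :=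
  z.submatrix Fin.succ Fin.succ

theorem minorMatrix_consRow_consCol {N : ℕ} (w : Matrix (Fin N) (Fin N) F) (v : Fin N → F)
    (r : Fin (N + 1) → F) : minorMatrix (consRow r (consCol v w)) = w := rfl

/-- A function of the minor has its Fourier support on matrices with zero first row and column;
padding the invertible N × N matrices by zeros gives 0/1 coefficients in the larger group. -/
theorem rectangleBound_rankWitness_minorMatrix {ψ : AddChar F ℂ} (hψ : ψ ≠ 1) (N : ℕ) :
    RectangleBound (fun z : Matrix (Fin (N + 1)) (Fin (N + 1)) F =>
      rankWitness (Fintype.card F) N (corank (minorMatrix z)))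
      ((Fintype.card (Matrix (Fin (N + 1)) (Fin (N + 1)) F) : ℝ) ^ 2) := by
  classical
  let ι : Matrix (Fin N) (Fin N) F ↪ Matrix (Fin (N + 1)) (Fin (N + 1)) F :=
    { toFun := fun y => consRow 0 (consCol 0 y)
      inj' := fun y y' h => by
        rw [← minorMatrix_consRow_consCol y 0 0, ← minorMatrix_consRow_consCol y' 0 0]
        exact congrArg minorMatrix h }
  have hι : ∀ y z, entryPairing (ι y) z = entryPairing y (minorMatrix z) := by
    intro y z
    have h0 : ∀ j, ι y 0 j = 0 := fun _ => rfl
    have h1 : ∀ i : Fin N, ι y i.succ 0 = 0 := fun _ => rfl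
    have h2 : ∀ i j : Fin N, ι y i.succ j.succ = y i j := fun _ _ => rfl
    simp [entryPairing, Fin.sum_univ_succ, minorMatrix, h0, h1, h2]
  have := (rectangleBound_of_fourier hψ
    (g := fun z => (-1) ^ N * rankWitness (Fintype.card F) N (corank (minorMatrix z)))
    (({y : Matrix (Fin N) (Fin N) F | LinearIndependent F y.row} : Finset _).map ι)
    (fun z => by
      rw [sum_addChar_entryPairing_linearIndependent hψ, Finset.sum_map]
      simp only [hι])).const_mul ((-1) ^ N)
  simpa [← mul_assoc, ← mul_pow] using this

/-- The players can multiply a function by the size of the kernel of `x + y` by announcing the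
image of a vector. -/
theorem RectangleBound.pow_corank_mul {n : ℕ} {g : Matrix (Fin n) (Fin n) F → ℝ} {B : ℝ}
    (h : RectangleBound g B) :
    RectangleBound (fun z => (Fintype.card F : ℝ) ^ corank z * g z)
      ((Fintype.card F : ℝ) ^ (2 * n) * B) := by
  classical
  intro S T
  have hk : ∀ z : Matrix (Fin n) (Fin n) F, (Fintype.card F : ℝ) ^ corank z =
      ∑ v : Fin n → F, if z *ᵥ v = 0 then (1 : ℝ) else 0 := by
    intro z
    rw [Finset.sum_boole]
    have : ({v : Fin n → F | z *ᵥ v = 0} : Finset _).card =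
        Fintype.card (LinearMap.ker z.mulVecLin) := by
      rw [Fintype.card_subtype]
      congr 1
      ext v
      simp
    rw [this, Module.card_eq_pow_finrank (K := F) (V := LinearMap.ker z.mulVecLin)]
    push_cast
    rfl
  -- For fixed v and c, the conditions x v = c and y v = -c restrict the players separately, so each
  -- of the q^(2n) pairs (v, c) gives a subrectangle.
  have hsplit : ∑ x ∈ S, ∑ y ∈ T, (Fintype.card F : ℝ) ^ corank (x + y) * g (x + y) =
      ∑ v : Fin n → F, ∑ c : Fin n → F,
        ∑ x ∈ S with x *ᵥ v = c, ∑ y ∈ T with y *ᵥ v = -c, g (x + y) := by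
    have h1 : ∀ x y : Matrix (Fin n) (Fin n) F,
        (Fintype.card F : ℝ) ^ corank (x + y) * g (x + y) =
        ∑ v : Fin n → F, if y *ᵥ v = -(x *ᵥ v) then g (x + y) else 0 := by
      intro x y
      rw [hk, Finset.sum_mul]
      refine Finset.sum_congr rfl fun v _ => ?_
      rw [ite_mul, one_mul, zero_mul, add_mulVec]
      exact if_congr (add_comm (x *ᵥ v) _ ▸ add_eq_zero_iff_eq_neg) rfl rfl
    simp only [h1]
    rw [Finset.sum_congr rfl fun x _ => Finset.sum_comm, Finset.sum_comm]
    refine Finset.sum_congr rfl fun v _ => ?_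
    rw [← Finset.sum_fiberwise S (fun x => x *ᵥ v)]
    refine Finset.sum_congr rfl fun c _ => Finset.sum_congr rfl fun x hx => ?_
    rw [(Finset.mem_filter.1 hx).2, Finset.sum_filter]
  rw [hsplit]
  refine (Finset.abs_sum_le_sum_abs _ _).trans ((Finset.sum_le_sum fun v _ =>
    (Finset.abs_sum_le_sum_abs _ _).trans (Finset.sum_le_sum fun c _ => h _ _)).trans
      (le_of_eq ?_))
  simp only [Finset.sum_const, Finset.card_univ, Fintype.card_fun, Fintype.card_fin, nsmul_eq_mul]
  push_cast
  ring

/-- The polynomial of degree `k` in `q ^ s` that is `1` at `s = 0` and vanishes at `s = 1, …, k`. -/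
noncomputable def corankSieve (q : ℝ) (k s : ℕ) : ℝ :=
  ∏ i ∈ Finset.range k, (q ^ (i + 1) - q ^ s) / (q ^ (i + 1) - 1)

theorem corankSieve_zero {q : ℝ} (hq : 1 < q) (k : ℕ) : corankSieve q k 0 = 1 := by
  refine Finset.prod_eq_one fun i _ => ?_
  rw [pow_zero, div_self]
  exact (sub_pos.2 (one_lt_pow₀ hq i.succ_ne_zero)).ne'

/-- For s ≤ k a factor of the sieve vanishes. For s > k the right side is |sieve| times (q^s - 1) /
(q^(k+1) - 1) ≥ 1. The bound is a frame count, whose moments are known. -/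
theorem abs_corankSieve_le {q : ℝ} (hq : 1 < q) (k : ℕ) {s : ℕ} (hs : 1 ≤ s) :
    |corankSieve q k s| ≤ frameCount q (k + 1) s / qFactorial q (k + 1) := by
  have hF := qFactorial_pos hq (k + 1)
  rcases lt_or_ge k s with h | h
  · have h1 : |corankSieve q k s| * qFactorial q k = ∏ i ∈ Finset.range k, (q ^ s - q ^ (i + 1)) := by
      rw [corankSieve, Finset.abs_prod, qFactorial, ← Finset.prod_mul_distrib]
      refine Finset.prod_congr rfl fun i hi => ?_
      have h2 : 0 < q ^ (i + 1) - 1 := sub_pos.2 (one_lt_pow₀ hq i.succ_ne_zero)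
      have h3 : q ^ (i + 1) ≤ q ^ s :=
        pow_le_pow_right₀ hq.le (by have := Finset.mem_range.1 hi; omega)
      rw [abs_div, abs_of_pos h2, div_mul_cancel₀ _ h2.ne', abs_sub_comm,
        abs_of_nonneg (sub_nonneg.2 h3)]
    rw [le_div_iff₀ hF, frameCount, Finset.prod_range_succ', pow_zero, ← h1, qFactorial_succ,
      ← mul_assoc]
    have h4 : q ^ (k + 1) ≤ q ^ s := pow_le_pow_right₀ hq.le h
    exact mul_le_mul_of_nonneg_left (by linarith)
      (mul_nonneg (abs_nonneg _) (qFactorial_nonneg hq.le k))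
  · have : corankSieve q k s = 0 := by
      refine Finset.prod_eq_zero (i := s - 1) (Finset.mem_range.2 (by omega)) ?_
      rw [Nat.sub_add_cancel hs, sub_self, zero_div]
    rw [this, abs_zero]
    exact div_nonneg (frameCount_nonneg hq.le _ _) hF.le

/-- Each sieve factor costs (x + Y) / (x - 1) ≤ 4Y, where x = q^(k+1) ≥ 2 and Y = q^(2n) ≥ 1. -/
theorem RectangleBound.corankSieve_mul {n : ℕ} {g : Matrix (Fin n) (Fin n) F → ℝ} {B : ℝ}
    (h : RectangleBound g B) (k : ℕ) :
    RectangleBound (fun z => corankSieve (Fintype.card F) k (corank z) * g z)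
      ((4 * (Fintype.card F : ℝ) ^ (2 * n)) ^ k * B) := by
  have hq : (2 : ℝ) ≤ Fintype.card F := by exact_mod_cast Fintype.one_lt_card (α := F)
  set q : ℝ := (Fintype.card F : ℝ) with hqdef
  induction k with
  | zero => simpa [corankSieve] using h
  | succ k ih =>
    have hB := ih.nonneg
    have hY : 1 ≤ q ^ (2 * n) := one_le_pow₀ (by linarith)
    have hx : 2 ≤ q ^ (k + 1) := hq.trans (le_self_pow₀ (by linarith) k.succ_ne_zero)
    have h1 := ((ih.const_mul (q ^ (k + 1))).sub ih.pow_corank_mul).const_mul (q ^ (k + 1) - 1)⁻¹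
    have h2 : (fun z : Matrix (Fin n) (Fin n) F => corankSieve q (k + 1) (corank z) * g z) =
        fun z => (q ^ (k + 1) - 1)⁻¹ * (q ^ (k + 1) * (corankSieve q k (corank z) * g z) -
          q ^ corank z * (corankSieve q k (corank z) * g z)) := by
      funext z
      rw [corankSieve, Finset.prod_range_succ, div_eq_mul_inv]
      simp only [corankSieve]
      ring
    rw [h2]
    refine h1.mono ?_
    have h3 : (4 * q ^ (2 * n)) ^ (k + 1) * B = 4 * q ^ (2 * n) * ((4 * q ^ (2 * n)) ^ k * B) := by
      ring
    rw [abs_of_nonneg (inv_nonneg.2 (by linarith)), abs_of_nonneg (by linarith),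
      inv_mul_le_iff₀ (by linarith), ← add_mul, h3, ← mul_assoc (q ^ (k + 1) - 1)]
    refine mul_le_mul_of_nonneg_right ?_ hB
    nlinarith

end Witness

/-! ### Numerical estimates for q-products and sums over coranks. -/

section Estimates

theorem choose_two_add_one (n : ℕ) : (n + 1).choose 2 = n + n.choose 2 := by
  rw [Nat.choose_succ_succ' n 1, Nat.choose_one_right]

theorem mul_self_eq_choose_two_add (n : ℕ) : n * n = n.choose 2 + (n + 1).choose 2 := by
  induction n with
  | zero => rfl
  | succ n ih =>
    have h1 := choose_two_add_one n
    have h2 := choose_two_add_one (n + 1)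
    have h3 : (n + 1) * (n + 1) = n * n + 2 * n + 1 := by ring
    omega

theorem add_mul_add_choose_two (m j : ℕ) :
    (m + j) * m + j.choose 2 = (m + 1).choose 2 + (m + j).choose 2 := by
  induction j with
  | zero => simpa [add_comm] using mul_self_eq_choose_two_add m
  | succ j ih =>
    have h4 := choose_two_add_one (m + j)
    have h5 := choose_two_add_one j
    have h6 : (m + (j + 1)) * m = (m + j) * m + m := by ring
    rw [h6, ← add_assoc m j 1]
    omega

theorem four_mul_add_six_le_choose_two (m : ℕ) : 4 * m + 6 ≤ (m + 4).choose 2 := by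
  induction m with
  | zero => decide
  | succ m ih =>
    have := choose_two_add_one (m + 4)
    rw [show m + 1 + 4 = m + 4 + 1 by ring]
    omega

variable {q : ℝ}

/-- The worst case is q = 2, where ∏ (1 - 2^(-i)) has to stay above 9/32. The first two factors give
3/8, and the decaying term (1/2)^(m+2) makes the bound inductive. -/
theorem qFactorial_ge_aux (hq : 2 ≤ q) (m : ℕ) :
    3 / 8 * (3 / 4 + (1 / 2) ^ (m + 2)) * q ^ (m + 3).choose 2 ≤ qFactorial q (m + 2) := by
  induction m with
  | zero =>
    have h3 : Nat.choose 3 2 = 3 := rfl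
    simp only [zero_add, h3, qFactorial, Finset.prod_range_succ, Finset.prod_range_zero, one_mul]
    have h4 : 2 * q ≤ q ^ 2 := by nlinarith
    have h5 : 2 * q ^ 2 ≤ q ^ 3 := by nlinarith [mul_nonneg (by linarith : (0:ℝ) ≤ q) (sub_nonneg.2 h4)]
    norm_num
    nlinarith [mul_nonneg (by linarith : (0:ℝ) ≤ q - 2) (by linarith : (0:ℝ) ≤ q)]
  | succ m ih =>
    rw [qFactorial_succ, choose_two_add_one (m + 3), pow_add q]
    have h1 : (1 - (1 / 2) ^ (m + 3)) * q ^ (m + 3) ≤ q ^ (m + 2 + 1) - 1 := by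
      have : 1 ≤ (1 / 2) ^ (m + 3) * q ^ (m + 3) := by
        rw [← mul_pow]
        exact one_le_pow₀ (by linarith)
      linarith
    set a : ℝ := (1 / 2) ^ (m + 2) with ha
    have ha1 : (1 / 2 : ℝ) ^ (m + 3) = a / 2 := by rw [pow_succ, ← ha]; ring
    have ha0 : 0 < a := by positivity
    have ha2 : a ≤ 1 / 4 := by
      rw [ha, pow_add]
      have : (1 / 2 : ℝ) ^ m ≤ 1 := pow_le_one₀ (by norm_num) (by norm_num)
      linarith
    have h2 : (0 : ℝ) ≤ 3 / 8 * (3 / 4 + a) * q ^ (m + 3).choose 2 := by positivity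
    rw [ha1] at h1
    refine le_trans ?_ (mul_le_mul ih h1
      (mul_nonneg (by linarith) (by positivity)) (h2.trans ih))
    have h3 : 3 / 8 * (3 / 4 + a) * q ^ (m + 3).choose 2 * ((1 - a / 2) * q ^ (m + 3)) =
        3 / 8 * ((3 / 4 + a) * (1 - a / 2)) * (q ^ (m + 3) * q ^ (m + 3).choose 2) := by ring
    rw [h3, show m + 1 + 2 = m + 3 by ring, ha1]
    have : 3 / 4 + a / 2 ≤ (3 / 4 + a) * (1 - a / 2) := by nlinarith
    gcongr

theorem qFactorial_ge (hq : 2 ≤ q) {m : ℕ} (hm : 2 ≤ m) :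
    9 / 32 * q ^ (m + 1).choose 2 ≤ qFactorial q m := by
  obtain ⟨m, rfl⟩ := Nat.exists_eq_add_of_le' hm
  refine le_trans ?_ (qFactorial_ge_aux hq m)
  gcongr
  have : (0 : ℝ) ≤ (1 / 2) ^ (m + 2) := by positivity
  linarith

/-- The weight `a` on corank `1` and `b` on corank at least `3`. -/
noncomputable def oddWeight (a b : ℝ) (t : ℕ) : ℝ := if t = 1 then a else if 3 ≤ t then b else 0

theorem oddWeight_nonneg {a b : ℝ} (ha : 0 ≤ a) (hb : 0 ≤ b) (t : ℕ) : 0 ≤ oddWeight a b t := by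
  unfold oddWeight
  split_ifs <;> first | assumption | exact le_rfl

/-- Corank 3 gives 1/8, and from 4 on the terms are below (1/64)(1/16)^m, with sum 1/60; altogether
17/120. -/
theorem sum_oddWeight_le_aux {a b : ℝ} (hb : 0 ≤ b) (m : ℕ) :
    ∑ t ∈ Finset.range (m + 4), oddWeight a b t / 2 ^ t.choose 2 ≤
      a + b * (17 / 120 - 1 / 60 * (1 / 16) ^ m) := by
  induction m with
  | zero =>
    have h3 : Nat.choose 3 2 = 3 := rfl
    simp only [Finset.sum_range_succ, Finset.sum_range_zero, oddWeight]
    norm_num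
    linarith
  | succ m ih =>
    rw [show m + 1 + 4 = m + 4 + 1 by ring, Finset.sum_range_succ]
    have h1 : oddWeight a b (m + 4) = b := by
      rw [oddWeight, if_neg (by omega), if_pos (by omega)]
    have h2 := four_mul_add_six_le_choose_two m
    have h3 : b / 2 ^ (m + 4).choose 2 ≤ b * (1 / 64 * (1 / 16) ^ m) := by
      rw [div_eq_mul_inv]
      refine mul_le_mul_of_nonneg_left ?_ hb
      calc ((2 : ℝ) ^ (m + 4).choose 2)⁻¹ ≤ (2 ^ (4 * m + 6))⁻¹ := by
            gcongr
            norm_num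
        _ = 1 / 64 * (1 / 16) ^ m := by
            rw [pow_add, pow_mul, mul_inv, one_div_pow]
            norm_num
            ring
    rw [h1, pow_succ]
    linarith

theorem sum_oddWeight_le {a b : ℝ} (ha : 0 ≤ a) (hb : 0 ≤ b) (hq : 2 ≤ q) (m : ℕ) :
    ∑ t ∈ Finset.range m, oddWeight a b t / q ^ t.choose 2 ≤ a + b * (17 / 120) := by
  have h0 := oddWeight_nonneg ha hb
  calc _ ≤ ∑ t ∈ Finset.range m, oddWeight a b t / 2 ^ t.choose 2 := by
        refine Finset.sum_le_sum fun t _ => ?_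
        have := h0 t
        gcongr
    _ ≤ ∑ t ∈ Finset.range (m + 4), oddWeight a b t / 2 ^ t.choose 2 := by
        refine Finset.sum_le_sum_of_subset_of_nonneg
          (Finset.range_subset_range.2 (by omega)) fun t _ _ => ?_
        have := h0 t
        positivity
    _ ≤ a + b * (17 / 120 - 1 / 60 * (1 / 16) ^ m) := sum_oddWeight_le_aux hb m
    _ ≤ a + b * (17 / 120) := by
        gcongr
        have : (0 : ℝ) ≤ (1 / 16) ^ m := by positivity
        linarith

theorem sum_one_div_two_pow_choose_le (m : ℕ) :
    ∑ j ∈ Finset.range (m + 1), (1 : ℝ) / 2 ^ j.choose 2 ≤ 3 - 2 * (1 / 2) ^ m := by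
  induction m with
  | zero => norm_num
  | succ m ih =>
    rw [Finset.sum_range_succ]
    have h1 : (1 : ℝ) / 2 ^ (m + 1).choose 2 ≤ (1 / 2) ^ m := by
      rw [one_div_pow]
      gcongr
      · norm_num
      · rw [choose_two_add_one]
        omega
    rw [pow_succ]
    linarith

/-- Terms with t < m vanish. By `add_mul_add_choose_two` the term t = m + j is at most q^((m+1)
choose 2) / q^(j choose 2), and the sum of 2^(-(j choose 2)) is below 3. -/
theorem sum_frameCount_div_le (hq : 2 ≤ q) (m M : ℕ) :
    ∑ t ∈ Finset.range M, frameCount q m t / q ^ t.choose 2 ≤ 3 * q ^ (m + 1).choose 2 := by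
  have hq1 : 1 ≤ q := by linarith
  have hq0 : 0 < q := by linarith
  have hpos : ∀ t, 0 ≤ frameCount q m t / q ^ t.choose 2 := fun t =>
    div_nonneg (frameCount_nonneg hq1 m t) (by positivity)
  calc _ ≤ ∑ t ∈ Finset.range (m + (M + 1)), frameCount q m t / q ^ t.choose 2 :=
        Finset.sum_le_sum_of_subset_of_nonneg
          (Finset.range_subset_range.2 (by omega)) fun t _ _ => hpos t
    _ = ∑ j ∈ Finset.range (M + 1), frameCount q m (m + j) / q ^ (m + j).choose 2 := by
        rw [Finset.sum_range_add, Finset.sum_eq_zero, zero_add]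
        intro t ht
        rw [frameCount_eq_zero (Finset.mem_range.1 ht), zero_div]
    _ ≤ ∑ j ∈ Finset.range (M + 1), q ^ (m + 1).choose 2 * (1 / 2 ^ j.choose 2) := by
        refine Finset.sum_le_sum fun j _ => ?_
        have h1 := frameCount_le hq1 m (m + j)
        have h2 := add_mul_add_choose_two m j
        have h3 : q ^ ((m + j) * m) * q ^ j.choose 2 = q ^ (m + 1).choose 2 * q ^ (m + j).choose 2 := by
          rw [← pow_add, ← pow_add, h2]
        calc frameCount q m (m + j) / q ^ (m + j).choose 2
            ≤ q ^ ((m + j) * m) / q ^ (m + j).choose 2 := by gcongr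
          _ = q ^ (m + 1).choose 2 * (1 / q ^ j.choose 2) := by
              field_simp
              linarith
          _ ≤ q ^ (m + 1).choose 2 * (1 / 2 ^ j.choose 2) := by gcongr
    _ ≤ q ^ (m + 1).choose 2 * 3 := by
        rw [← Finset.mul_sum]
        refine mul_le_mul_of_nonneg_left ?_ (by positivity)
        have := sum_one_div_two_pow_choose_le M
        have : (0 : ℝ) ≤ (1 / 2) ^ M := by positivity
        linarith
    _ = 3 * q ^ (m + 1).choose 2 := mul_comm _ _

end Estimates

/-! ### The mass of the rank witness by corank. -/

section Mass

set_option linter.unusedSectionVars false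

open Matrix

variable {F : Type} [Field F] [Fintype F]

/-- The total weight of the witness, as a sum over coranks. -/
theorem sum_mul_abs_rankWitness_le (N : ℕ) {ρ : ℕ → ℝ} (hρ : ∀ t, 0 ≤ ρ t) :
    ∑ z : Matrix (Fin N) (Fin N) F, ρ (corank z) * |rankWitness (Fintype.card F) N (corank z)| ≤
      (Fintype.card F : ℝ) ^ (N * N + N.choose 2) *
        ∑ t ∈ Finset.range (N + 1), ρ t / (Fintype.card F : ℝ) ^ t.choose 2 := by
  classical
  have hq : (2 : ℝ) ≤ Fintype.card F := by exact_mod_cast Fintype.one_lt_card (α := F)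
  rw [← Finset.sum_fiberwise_of_maps_to (t := Finset.range (N + 1)) (g := corank)
    (fun z _ => Finset.mem_range.2 (Nat.lt_succ_of_le (corank_le z))), Finset.mul_sum]
  refine Finset.sum_le_sum fun t _ => ?_
  have h1 := card_corank_mul_le (F := F) N t
  set q : ℝ := (Fintype.card F : ℝ) with hqd
  have h2 : ∑ z : Matrix (Fin N) (Fin N) F with corank z = t,
      ρ (corank z) * |rankWitness q N (corank z)| =
      (({z : Matrix (Fin N) (Fin N) F | corank z = t} : Finset _).card : ℝ) *
        (ρ t * (q ^ N.choose 2 * qFactorial q t)) := by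
    rw [← nsmul_eq_mul, ← Finset.sum_const]
    refine Finset.sum_congr rfl fun z hz => ?_
    rw [(Finset.mem_filter.1 hz).2, abs_rankWitness (by linarith)]
  rw [h2]
  -- The q-factorial in the witness cancels the one in the corank count, leaving 1 / q^(t choose 2).
  rw [frameCount_self] at h1
  have h3 : 0 < q ^ t.choose 2 := by positivity
  rw [mul_div_assoc', le_div_iff₀ h3, pow_add]
  have := mul_le_mul_of_nonneg_left h1 (mul_nonneg (hρ t) (by positivity : 0 ≤ q ^ N.choose 2))
  linarith

open Classical in
theorem card_corank_eq_zero_ge {N : ℕ} (hN : 2 ≤ N) :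
    9 / 32 * (Fintype.card F : ℝ) ^ (N * N) ≤
      (({z : Matrix (Fin N) (Fin N) F | corank z = 0} : Finset _).card : ℝ) := by
  have hq : (2 : ℝ) ≤ Fintype.card F := by exact_mod_cast Fintype.one_lt_card (α := F)
  rw [card_corank_eq_zero, frameCount_self]
  rw [mul_self_eq_choose_two_add, pow_add, mul_left_comm]
  exact mul_le_mul_of_nonneg_left (qFactorial_ge hq hN) (by positivity)

end Mass

/-! ### Correlation lower bounds for the rank and inverse problems. -/

section LowerBounds

open Matrix

theorem ZMod.stdAddChar_ne_one (p : ℕ) [Fact p.Prime] :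
    (ZMod.stdAddChar : AddChar (ZMod p) ℂ) ≠ 1 :=
  AddChar.ne_one_iff.2 ⟨1, fun h => one_ne_zero (ZMod.injective_stdAddChar
    (h.trans (AddChar.map_zero_eq_one _).symm))⟩

theorem card_matrix_zmod (p n : ℕ) [Fact p.Prime] :
    (Fintype.card (Matrix (Fin n) (Fin n) (ZMod p)) : ℝ) = (p : ℝ) ^ (n * n) := by
  rw [Fintype.card_congr Matrix.of.symm, Fintype.card_fun, Fintype.card_fun, ZMod.card,
    Fintype.card_fin, ← pow_mul]
  push_cast
  rfl

variable {p : ℕ} [Fact p.Prime]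

theorem pow_choose_le_rankProblem {n : ℕ} (hn : 2 ≤ n) :
    (p : ℝ) ^ n.choose 2 ≤ 100 * 2 ^ publicCoinComplexity (1 / 10) (rankProblem p n (n - 1)) := by
  classical
  have hp : (2 : ℝ) ≤ p := by exact_mod_cast (Fact.out : p.Prime).two_le
  have hp1 : (1 : ℝ) ≤ p := by linarith
  have hrect := rectangleBound_rankWitness (ZMod.stdAddChar_ne_one p) n
  have hmass := sum_mul_abs_rankWitness_le (F := ZMod p) n
    (oddWeight_nonneg (a := 1 / 10) (b := 1) (by norm_num) (by norm_num))
  have hcount := card_corank_eq_zero_ge (F := ZMod p) hn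
  rw [ZMod.card] at hrect hmass hcount
  set W : ℕ → ℝ := rankWitness (p : ℝ) n with hW
  -- Corank 1 is charged at the error rate 1/10. Odd coranks from 3 on violate the promise and are
  -- charged in full, while positive even coranks are dropped because the witness is nonnegative
  -- there.
  set φ : Matrix (Fin n) (Fin n) (ZMod p) → ℝ := fun z =>
    (if corank z = 0 then 9 / 10 * (p : ℝ) ^ n.choose 2 else 0) -
      oddWeight (1 / 10) 1 (corank z) * |W (corank z)| with hφ
  have hbound := card_mul_sum_le_of_rectangleBound (δ := 1 / 10) (φ := φ) (by norm_num) hrect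
    (rankProblem p n (n - 1)) {n} (by
      intro x y a ha0 ha1 hacc hrej
      have hrank := rank_add_corank (x + y)
      simp only [hφ]
      generalize hz : x + y = z at *
      have hpromise : (rankProblem p n (n - 1)).promise x y ↔ z.rank = n - 1 ∨ z.rank = n - 1 + 1 := by
        rw [← hz]
        rfl
      have hanswer : (rankProblem p n (n - 1)).answer x y = z.rank := by
        rw [← hz]
        rfl
      rw [hpromise, hanswer] at hacc hrej
      generalize corank z = t at *
      rcases Nat.eq_zero_or_pos t with rfl | ht
      · have h1 : W 0 = (p : ℝ) ^ n.choose 2 := by simp [hW, rankWitness, qFactorial]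
        have h2 := hacc (Or.inr (by omega)) (by simpa using hrank)
        have h3 : 0 ≤ (p : ℝ) ^ n.choose 2 := by positivity
        rw [if_pos rfl, h1, oddWeight]
        norm_num
        nlinarith
      · rw [if_neg ht.ne', zero_sub]
        have hWa : 0 ≤ |W t| := abs_nonneg _
        rcases Nat.even_or_odd t with he | ho
        · have h1 : W t = |W t| := rankWitness_of_even hp1 he
          have h2 := oddWeight_nonneg (a := 1 / 10) (b := 1) (by norm_num) (by norm_num) t
          rw [h1, abs_abs]
          nlinarith [mul_nonneg h2 hWa, mul_nonneg hWa ha0]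
        · have h1 : W t = -|W t| := rankWitness_of_odd hp1 ho
          have h2 : a ≤ oddWeight (1 / 10) 1 t := by
            by_cases ht1 : t = 1
            · rw [oddWeight, if_pos ht1]
              exact hrej (Or.inl (by omega)) (by rw [Set.mem_singleton_iff]; omega)
            · have : t ≠ 2 := by
                rintro rfl
                exact absurd ho (by decide)
              rw [oddWeight, if_neg ht1, if_pos (by omega)]
              exact ha1
          rw [h1, abs_neg, abs_abs]
          nlinarith [mul_le_mul_of_nonneg_right h2 hWa])
  rw [card_matrix_zmod] at hbound
  -- Numerically, (9/32)(9/10) - (1/10 + 17/120) > 1/100.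
  have hsum : (p : ℝ) ^ (n * n) * (p : ℝ) ^ n.choose 2 / 100 ≤ ∑ z, φ z := by
    have h1 := sum_oddWeight_le (a := 1 / 10) (b := 1) (by norm_num) (by norm_num) hp (n + 1)
    have h2 := hmass.trans (mul_le_mul_of_nonneg_left h1 (by positivity))
    simp only [hφ, Finset.sum_sub_distrib]
    rw [← Finset.sum_filter, Finset.sum_const, nsmul_eq_mul]
    rw [pow_add] at h2
    have h3 := mul_le_mul_of_nonneg_right hcount (by positivity : 0 ≤ 9 / 10 * (p : ℝ) ^ n.choose 2)
    have h4 : 0 ≤ (p : ℝ) ^ (n * n) * (p : ℝ) ^ n.choose 2 := by positivity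
    linarith
  have hG : 0 < (p : ℝ) ^ (n * n) := by positivity
  have := (mul_le_mul_of_nonneg_left hsum hG.le).trans hbound
  have h5 : (p : ℝ) ^ (n * n) * (p : ℝ) ^ (n * n) * (p : ℝ) ^ n.choose 2 ≤
      (p : ℝ) ^ (n * n) * (p : ℝ) ^ (n * n) *
        (100 * 2 ^ publicCoinComplexity (1 / 10) (rankProblem p n (n - 1))) := by
    nlinarith
  exact le_of_mul_le_mul_left h5 (by positivity)

/-- A pointwise lower bound for the witness for the top-left entry of the inverse times the
acceptance probability of a protocol. -/
noncomputable def inverseMinorant {N : ℕ} (m : ℕ) (w : Matrix (Fin N) (Fin N) (ZMod p))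
    (z : Matrix (Fin (N + 1)) (Fin (N + 1)) (ZMod p)) : ℝ :=
  (if corank w = 0 ∧ corank z = 0 then 9 / 10 * (p : ℝ) ^ N.choose 2 else 0) -
    oddWeight (1 / 10) (1 / 10) (corank w) * |rankWitness p N (corank w)| -
    |rankWitness p N (corank w)| * (frameCount p m (corank z) / qFactorial p m)

/-- For invertible `z` the sieve is 1 and the parity of the minor's corank decides the sign. For
singular `z` nothing is known about `a`, and the whole product is charged through
`abs_corankSieve_le`. -/
theorem inverseMinorant_le {N k : ℕ} (z : Matrix (Fin (N + 1)) (Fin (N + 1)) (ZMod p)) {a : ℝ}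
    (ha0 : 0 ≤ a) (ha1 : a ≤ 1)
    (hacc : corank z = 0 → corank (minorMatrix z) = 0 → 1 - 1 / 10 ≤ a)
    (hrej : corank z = 0 → corank (minorMatrix z) ≠ 0 → a ≤ 1 / 10) :
    inverseMinorant (k + 1) (minorMatrix z) z ≤
      corankSieve p k (corank z) * rankWitness p N (corank (minorMatrix z)) * a := by
  have hp : (2 : ℝ) ≤ p := by exact_mod_cast (Fact.out : p.Prime).two_le
  have hp1 : (1 : ℝ) < p := by linarith
  unfold inverseMinorant
  generalize corank (minorMatrix z) = t at *
  generalize corank z = s at *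
  have hW0 : 0 ≤ |rankWitness (p : ℝ) N t| := abs_nonneg _
  have ho0 := oddWeight_nonneg (a := 1 / 10) (b := 1 / 10) (by norm_num) (by norm_num) t
  rcases Nat.eq_zero_or_pos s with rfl | hs
  · rw [frameCount_eq_zero k.succ_pos, zero_div, mul_zero, sub_zero, corankSieve_zero hp1, one_mul]
    rcases Nat.eq_zero_or_pos t with rfl | ht
    · have h1 : rankWitness p N 0 = (p : ℝ) ^ N.choose 2 := by simp [rankWitness, qFactorial]
      have h2 := hacc rfl rfl
      have h3 : 0 ≤ (p : ℝ) ^ N.choose 2 := by positivity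
      rw [if_pos ⟨rfl, rfl⟩, h1, oddWeight]
      norm_num
      nlinarith
    · rw [if_neg (fun h => ht.ne' h.1), zero_sub]
      rcases Nat.even_or_odd t with he | ho
      · rw [rankWitness_of_even hp1.le he, abs_abs]
        nlinarith [mul_nonneg ho0 hW0, mul_nonneg hW0 ha0]
      · have h2 : a ≤ oddWeight (1 / 10) (1 / 10) t := by
          have ht2 : t ≠ 2 := by
            rintro rfl
            exact absurd ho (by decide)
          refine (hrej rfl ht.ne').trans (le_of_eq ?_)
          rw [oddWeight]
          split_ifs
          · rfl
          · rfl
          · omega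
        rw [rankWitness_of_odd hp1.le ho, abs_neg, abs_abs]
        nlinarith [mul_le_mul_of_nonneg_right h2 hW0]
  · rw [if_neg (fun h => hs.ne' h.2), zero_sub]
    have h1 := abs_corankSieve_le hp1 k hs
    have h2 : |corankSieve p k s * rankWitness p N t * a| ≤
        |rankWitness (p : ℝ) N t| * (frameCount p (k + 1) s / qFactorial p (k + 1)) := by
      rw [abs_mul, abs_mul, abs_of_nonneg ha0, mul_comm |corankSieve _ _ _|]
      refine (mul_le_of_le_one_right (by positivity) ha1).trans ?_
      exact mul_le_mul_of_nonneg_left h1 hW0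
    nlinarith [neg_abs_le (corankSieve p k s * rankWitness p N t * a), mul_nonneg ho0 hW0]

/-- First moment: 1 - (p^s - 1)/(p - 1) is at most the indicator of corank s = 0, and the subtracted
term averages at most 1/p ≤ 1/2 over the extensions of an invertible `w`. -/
theorem card_extend_corank_eq_zero_ge {N : ℕ} {w : Matrix (Fin N) (Fin N) (ZMod p)}
    (hw : corank w = 0) :
    (p : ℝ) ^ (2 * N + 1) / 2 ≤
      ∑ v, ∑ r, if corank (consRow r (consCol v w)) = 0 then (1 : ℝ) else 0 := by
  have hp : (2 : ℝ) ≤ p := by exact_mod_cast (Fact.out : p.Prime).two_le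
  have h1 := sum_frameCount_corank_extend_le w 1
  have h2 : ∀ v r, 1 - frameCount p 1 (corank (consRow r (consCol v w))) / ((p : ℝ) - 1) ≤
      if corank (consRow r (consCol v w)) = 0 then (1 : ℝ) else 0 := by
    intro v r
    split_ifs with h
    · rw [h, frameCount_eq_zero Nat.one_pos, zero_div, sub_zero]
    · rw [sub_nonpos, le_div_iff₀ (by linarith), one_mul, frameCount, Finset.prod_range_one, pow_zero]
      gcongr
      exact le_self_pow₀ (by linarith) h
  refine le_trans ?_ (Finset.sum_le_sum fun v _ => Finset.sum_le_sum fun r _ => h2 v r)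
  simp only [Finset.sum_sub_distrib, ← Finset.sum_div, Finset.sum_const, Finset.card_univ,
    Fintype.card_fun, Fintype.card_fin, ZMod.card, nsmul_eq_mul, mul_one]
  rw [ZMod.card, hw] at h1
  simp only [frameCount, Finset.prod_range_one, pow_zero, pow_one, mul_one, zero_add, sub_self,
    mul_zero] at h1
  have h3 : (∑ v, ∑ r, frameCount p 1 (corank (consRow r (consCol v w)))) / ((p : ℝ) - 1) ≤
      (p : ℝ) ^ (2 * N) := by
    rw [div_le_iff₀ (by linarith)]
    simp only [frameCount, Finset.prod_range_one, pow_zero]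
    refine le_of_mul_le_mul_right (h1.trans (le_of_eq ?_)) (by linarith : (0 : ℝ) < p)
    ring
  push_cast
  have h4 : (p : ℝ) ^ N * (p : ℝ) ^ (N + 1) = p * (p : ℝ) ^ (2 * N) := by ring
  have h5 : (p : ℝ) ^ (2 * N + 1) = p * (p : ℝ) ^ (2 * N) := by ring
  have h6 : 0 ≤ (p : ℝ) ^ (2 * N) := by positivity
  rw [h4, h5]
  nlinarith

theorem sum_extend_frameCount_le {N m : ℕ} (w : Matrix (Fin N) (Fin N) (ZMod p)) :
    ∑ v, ∑ r, frameCount p m (corank (consRow r (consCol v w))) ≤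
      (p : ℝ) ^ (2 * N + 1) / (p : ℝ) ^ m * (frameCount p m (corank w) +
        frameCount p m (corank w + 1) / (p : ℝ) ^ corank w) := by
  have hp : (0 : ℝ) < p := by exact_mod_cast (Fact.out : p.Prime).pos
  have h1 := sum_frameCount_corank_extend_le w m
  rw [ZMod.card] at h1
  rw [← le_div_iff₀ (by positivity)] at h1
  refine h1.trans (le_of_eq ?_)
  field_simp

/-- Since q^t · q^(t choose 2) = q^((t+1) choose 2), the second summand is the first one shifted by
one, and `sum_frameCount_div_le` applies to both. -/
theorem sum_kernelWeight_le {q : ℝ} (hq : 2 ≤ q) {m : ℕ} (M : ℕ) :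
    ∑ t ∈ Finset.range M, (frameCount q m t + frameCount q m (t + 1) / q ^ t) / q ^ t.choose 2 ≤
      6 * q ^ (m + 1).choose 2 := by
  have h1 := sum_frameCount_div_le hq m M
  have h2 := sum_frameCount_div_le hq m (M + 1)
  have h0 : 0 ≤ frameCount q m 0 / q ^ Nat.choose 0 2 :=
    div_nonneg (frameCount_nonneg (by linarith) m 0) (by positivity)
  rw [Finset.sum_range_succ'] at h2
  have h3 : ∀ t, (frameCount q m t + frameCount q m (t + 1) / q ^ t) / q ^ t.choose 2 =
      frameCount q m t / q ^ t.choose 2 + frameCount q m (t + 1) / q ^ (t + 1).choose 2 := by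
    intro t
    rw [add_div, div_div, ← pow_add, choose_two_add_one]
  simp only [h3, Finset.sum_add_distrib]
  linarith

theorem sum_inverseMinorant_ge {N : ℕ} (hN : 2 ≤ N) :
    (p : ℝ) ^ ((N + 1) * (N + 1)) * (p : ℝ) ^ N.choose 2 / 100 ≤
      ∑ z : Matrix (Fin (N + 1)) (Fin (N + 1)) (ZMod p), inverseMinorant 16 (minorMatrix z) z := by
  classical
  have hp : (2 : ℝ) ≤ p := by exact_mod_cast (Fact.out : p.Prime).two_le
  have hp1 : (1 : ℝ) ≤ p := by linarith
  set K : ℝ := (p : ℝ) ^ N.choose 2 with hK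
  set L : ℝ := (p : ℝ) ^ (2 * N + 1) with hL
  have hK0 : 0 < K := by positivity
  have hL0 : 0 < L := by positivity
  set D : ℝ := qFactorial (p : ℝ) 16 with hD
  have hD1 : 9 / 32 * (p : ℝ) ^ Nat.choose 17 2 ≤ D := qFactorial_ge hp (by norm_num)
  have hD0 : 0 < D := lt_of_lt_of_le (by positivity) hD1
  set ρ : ℕ → ℝ := fun t => frameCount p 16 t + frameCount p 16 (t + 1) / (p : ℝ) ^ t with hρ
  have hρ0 : ∀ t, 0 ≤ ρ t := fun t => add_nonneg (frameCount_nonneg hp1 _ _)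
    (div_nonneg (frameCount_nonneg hp1 _ _) (by positivity))
  have hodd := sum_mul_abs_rankWitness_le (F := ZMod p) N
    (oddWeight_nonneg (a := 1 / 10) (b := 1 / 10) (by norm_num) (by norm_num))
  have hker := sum_mul_abs_rankWitness_le (F := ZMod p) N hρ0
  have hcount := card_corank_eq_zero_ge (F := ZMod p) hN
  rw [ZMod.card, pow_add] at hodd hker
  rw [ZMod.card] at hcount
  set X : ℝ := (p : ℝ) ^ (N * N) with hX
  have hX0 : 0 < X := by positivity
  have hodd' := hodd.trans (mul_le_mul_of_nonneg_left
    (sum_oddWeight_le (a := 1 / 10) (b := 1 / 10) (by norm_num) (by norm_num) hp (N + 1))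
    (by positivity))
  have hker' := hker.trans (mul_le_mul_of_nonneg_left (sum_kernelWeight_le hp (N + 1))
    (by positivity))
  have hfiber : ∀ w : Matrix (Fin N) (Fin N) (ZMod p),
      (if corank w = 0 then 9 / 20 * K * L else 0) -
        L * (oddWeight (1 / 10) (1 / 10) (corank w) * |rankWitness p N (corank w)|) -
        L / ((p : ℝ) ^ 16 * D) * (ρ (corank w) * |rankWitness p N (corank w)|) ≤
      ∑ v, ∑ r, inverseMinorant 16 w (consRow r (consCol v w)) := by
    intro w
    have h1 := sum_extend_frameCount_le (m := 16) w
    have hcard : (∑ v : Fin N → ZMod p, ∑ r : Fin (N + 1) → ZMod p, (1 : ℝ)) = L := by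
      simp only [Finset.sum_const, Finset.card_univ, Fintype.card_fun, Fintype.card_fin, ZMod.card,
        nsmul_eq_mul, mul_one]
      push_cast
      rw [hL]
      ring
    have h2 : ∑ v, ∑ r, inverseMinorant 16 w (consRow r (consCol v w)) =
        (if corank w = 0 then 9 / 10 * K *
          ∑ v, ∑ r, (if corank (consRow r (consCol v w)) = 0 then (1 : ℝ) else 0) else 0) -
        (∑ v : Fin N → ZMod p, ∑ r : Fin (N + 1) → ZMod p, (1 : ℝ)) *
          (oddWeight (1 / 10) (1 / 10) (corank w) * |rankWitness p N (corank w)|) -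
        |rankWitness p N (corank w)| / D *
          ∑ v, ∑ r, frameCount p 16 (corank (consRow r (consCol v w))) := by
      simp only [inverseMinorant, Finset.sum_sub_distrib, Finset.sum_mul, Finset.mul_sum, one_mul]
      congr 1
      · congr 1
        split_ifs with h
        · simp [h, hK]
        · simp [h]
      · refine Finset.sum_congr rfl fun v _ => Finset.sum_congr rfl fun r _ => ?_
        rw [hD]
        ring
    rw [h2, hcard]
    refine sub_le_sub (sub_le_sub_right ?_ _) ?_
    · split_ifs with h
      · have := mul_le_mul_of_nonneg_left (card_extend_corank_eq_zero_ge h)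
          (by positivity : 0 ≤ 9 / 10 * K)
        linarith
      · exact le_rfl
    · refine (mul_le_mul_of_nonneg_left h1 (by positivity)).trans (le_of_eq ?_)
      simp only [hρ, hL]
      field_simp
  have htotal : ∑ z : Matrix (Fin (N + 1)) (Fin (N + 1)) (ZMod p), inverseMinorant 16 (minorMatrix z) z =
      ∑ w : Matrix (Fin N) (Fin N) (ZMod p), ∑ v, ∑ r,
        inverseMinorant 16 w (consRow r (consCol v w)) := by
    rw [sum_consRow, sum_consCol]
    rfl
  rw [htotal]
  refine le_trans ?_ (Finset.sum_le_sum fun w _ => hfiber w)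
  rw [Finset.sum_sub_distrib, Finset.sum_sub_distrib, ← Finset.mul_sum, ← Finset.mul_sum,
    ← Finset.sum_filter, Finset.sum_const, nsmul_eq_mul]
  have h1 := mul_le_mul_of_nonneg_right hcount (by positivity : 0 ≤ 9 / 20 * K * L)
  have h2 := mul_le_mul_of_nonneg_left hodd' hL0.le
  -- This is where 15 sieve factors suffice: q^(17 choose 2) cancels, and the remaining ratio is at
  -- most 6 · (32/9) / 2^16 < 1/1000.
  have h3 : L / ((p : ℝ) ^ 16 * D) * ∑ w : Matrix (Fin N) (Fin N) (ZMod p),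
      ρ (corank w) * |rankWitness p N (corank w)| ≤ L * (X * K) * (1 / 1000) := by
    refine (mul_le_mul_of_nonneg_left hker' (by positivity)).trans ?_
    rw [div_mul_eq_mul_div, div_le_iff₀ (by positivity)]
    have h4 : (2 : ℝ) ^ 16 ≤ (p : ℝ) ^ 16 := by gcongr
    have h5 : 6 * (p : ℝ) ^ Nat.choose (16 + 1) 2 ≤ 1 / 1000 * ((p : ℝ) ^ 16 * D) := by
      have h6 : (0 : ℝ) < (p : ℝ) ^ Nat.choose 17 2 := by positivity
      have h7 := mul_le_mul h4 hD1 (by positivity) (by positivity)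
      have h8 : Nat.choose (16 + 1) 2 = Nat.choose 17 2 := rfl
      rw [h8]
      generalize (p : ℝ) ^ Nat.choose 17 2 = P at *
      generalize (p : ℝ) ^ 16 * D = R at *
      norm_num at h7
      linarith
    have := mul_le_mul_of_nonneg_left h5 (by positivity : 0 ≤ L * (X * K))
    linarith
  have h4 : (p : ℝ) ^ ((N + 1) * (N + 1)) = L * X := by
    rw [hL, hX]
    ring
  have h5 : 0 < L * X * K := by positivity
  -- Numerically, (9/32)(9/20) - (1/10)(1 + 17/120) - 1/1000 > 1/100.
  rw [h4]
  linarith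

end LowerBounds

/-! ### Reduction of the three problems to the correlation bounds. -/

section MainTheorem

open Matrix

theorem inv_zero_zero_eq_zero_iff {F : Type} [Field F] [Fintype F] {N : ℕ}
    {z : Matrix (Fin (N + 1)) (Fin (N + 1)) F} (hz : IsUnit z) :
    z⁻¹ 0 0 = 0 ↔ corank (minorMatrix z) ≠ 0 := by
  have hdet : z.det ≠ 0 := ((isUnit_iff_isUnit_det z).1 hz).ne_zero
  rw [Ne, corank_eq_zero_iff_isUnit, isUnit_iff_isUnit_det, isUnit_iff_ne_zero, not_not, inv_def,
    Matrix.smul_apply, smul_eq_mul, Ring.inverse_eq_inv', mul_eq_zero_iff_left (inv_ne_zero hdet),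
    adjugate_fin_succ_eq_det_submatrix]
  simp [minorMatrix]

/-- A vector `b ≠ 0` is the first column of some invertible matrix. -/
theorem exists_isUnit_mulVec_single {F : Type} [Field F] {n : ℕ} [NeZero n] {b : Fin n → F}
    (hb : b ≠ 0) : ∃ M : Matrix (Fin n) (Fin n) F, IsUnit M ∧ M *ᵥ Pi.single 0 1 = b := by
  obtain ⟨j, hj⟩ := Function.ne_iff.1 hb
  refine ⟨((1 : Matrix (Fin n) (Fin n) F).updateCol j b).submatrix id (Equiv.swap 0 j), ?_, ?_⟩
  · rw [show (id : Fin n → Fin n) = Equiv.refl _ from rfl, isUnit_submatrix_equiv,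
      isUnit_iff_isUnit_det, ← cramer_apply, cramer_one]
    exact isUnit_iff_ne_zero.2 hj
  · ext i
    simp

variable {p : ℕ} [Fact p.Prime]

/-- Left multiplication by the invertible `R` is an additive bijection, so it carries rectangles to
rectangles and preserves the total mass. This treats the inverse and the linear system together. -/
theorem pow_choose_le_of_inverse_entry {N : ℕ} (hN : 2 ≤ N)
    {R : Matrix (Fin (N + 1)) (Fin (N + 1)) (ZMod p)} (hR : IsUnit R)
    (P : PromiseProblem (Matrix (Fin (N + 1)) (Fin (N + 1)) (ZMod p))
      (Matrix (Fin (N + 1)) (Fin (N + 1)) (ZMod p)) Bool)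
    (hpromise : ∀ x y, IsUnit (x + y) → P.promise x y)
    (hanswer : ∀ x y, IsUnit (x + y) → (P.answer x y = true ↔ (R * (x + y))⁻¹ 0 0 = 0)) :
    (p : ℝ) ^ N.choose 2 ≤
      100 * (4 * (p : ℝ) ^ (2 * (N + 1))) ^ 15 * 2 ^ publicCoinComplexity (1 / 10) P := by
  have hp : (2 : ℝ) ≤ p := by exact_mod_cast (Fact.out : p.Prime).two_le
  have hinj : Function.Injective (AddMonoidHom.mulLeft R) := by
    intro x y hxy
    exact hR.mul_left_cancel hxy
  have hrect := ((rectangleBound_rankWitness_minorMatrix (ZMod.stdAddChar_ne_one p)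
    N).corankSieve_mul 15).comp_injective (AddMonoidHom.mulLeft R) hinj
  simp only [AddMonoidHom.coe_mulLeft] at hrect
  have hbound := card_mul_sum_le_of_rectangleBound (δ := 1 / 10)
    (φ := fun z => inverseMinorant 16 (minorMatrix (R * z)) (R * z)) (by norm_num) hrect P {false}
    (by
      intro x y a ha0 ha1 hacc hrej
      have hunit : corank (R * (x + y)) = 0 → IsUnit (x + y) := fun h => by
        rw [corank_eq_zero_iff_isUnit] at h
        exact (IsUnit.mul_iff.1 h).2
      simp only [ZMod.card]
      refine inverseMinorant_le _ ha0 ha1 (fun h h0 => ?_) (fun h h0 => ?_)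
      · have hu := hunit h
        refine hacc (hpromise x y hu) ?_
        rw [Set.mem_singleton_iff, ← Bool.not_eq_true, hanswer x y hu,
          inv_zero_zero_eq_zero_iff (corank_eq_zero_iff_isUnit.1 h)]
        exact not_not.2 h0
      · have hu := hunit h
        refine hrej (hpromise x y hu) ?_
        rw [Set.mem_singleton_iff, ← Bool.not_eq_true, hanswer x y hu,
          inv_zero_zero_eq_zero_iff (corank_eq_zero_iff_isUnit.1 h)]
        exact not_not.2 h0)
  have hsum : ∑ z, inverseMinorant 16 (minorMatrix (R * z)) (R * z) =
      ∑ z : Matrix (Fin (N + 1)) (Fin (N + 1)) (ZMod p), inverseMinorant 16 (minorMatrix z) z :=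
    Function.Bijective.sum_comp (Finite.injective_iff_bijective.1 hinj)
      (fun z => inverseMinorant 16 (minorMatrix z) z)
  rw [hsum, card_matrix_zmod, ZMod.card] at hbound
  have hG : 0 < (p : ℝ) ^ ((N + 1) * (N + 1)) := by positivity
  have := (mul_le_mul_of_nonneg_left (sum_inverseMinorant_ge hN) hG.le).trans hbound
  refine le_of_mul_le_mul_left (a := ((p : ℝ) ^ ((N + 1) * (N + 1))) ^ 2) ?_ (by positivity)
  linarith

theorem mul_log_le_of_pow_le {N c : ℕ} (hN : 200 ≤ N)
    (h : (p : ℝ) ^ N.choose 2 ≤ 100 * (4 * (p : ℝ) ^ (2 * (N + 1))) ^ 15 * 2 ^ c) :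
    1 / 8 * ((N + 1 : ℕ) : ℝ) ^ 2 * Real.log p ≤ c := by
  have hp : (2 : ℝ) ≤ p := by exact_mod_cast (Fact.out : p.Prime).two_le
  have hp0 : (0 : ℝ) < p := by linarith
  have h1 : (100 : ℝ) ≤ (p : ℝ) ^ 7 := by
    have : (2 : ℝ) ^ 7 ≤ (p : ℝ) ^ 7 := by gcongr
    linarith
  have h2 : (4 : ℝ) ≤ (p : ℝ) ^ 2 := by nlinarith
  have h3 : (p : ℝ) ^ N.choose 2 ≤ (p : ℝ) ^ (30 * N + 67) * 2 ^ c := by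
    refine h.trans ?_
    calc (100 : ℝ) * (4 * (p : ℝ) ^ (2 * (N + 1))) ^ 15 * 2 ^ c
        ≤ (p : ℝ) ^ 7 * ((p : ℝ) ^ 2 * (p : ℝ) ^ (2 * (N + 1))) ^ 15 * 2 ^ c := by gcongr
      _ = (p : ℝ) ^ (30 * N + 67) * 2 ^ c := by ring
  have h4 := Real.log_le_log (by positivity) h3
  rw [Real.log_mul (by positivity) (by positivity), Real.log_pow, Real.log_pow, Real.log_pow,
    Nat.cast_choose_two] at h4
  have hlog2 : Real.log 2 ≤ 1 := by linarith [Real.log_two_lt_d9]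
  have hlogp : 0 ≤ Real.log p := Real.log_nonneg (by linarith)
  have hc : (c : ℝ) * Real.log 2 ≤ c := mul_le_of_le_one_right (Nat.cast_nonneg c) hlog2
  have hNr : (200 : ℝ) ≤ N := by exact_mod_cast hN
  -- The loss p^(30N + 67) from the sieve and the constants is linear in N in the exponent, so N ≥
  -- 200 leaves a quadratic remainder.
  have h5 : 1 / 8 * ((N : ℝ) + 1) ^ 2 ≤ N * (N - 1) / 2 - (30 * N + 67) := by nlinarith
  have h6 := mul_le_mul_of_nonneg_right h5 hlogp
  push_cast at h4 ⊢
  linarith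

end MainTheorem

theorem theorem1 :
    ∃ c : ℝ, 0 < c ∧ ∃ n₀ : ℕ, ∀ (n : ℕ) [NeZero n] (p : ℕ) [Fact p.Prime], n₀ ≤ n →
      c * (n : ℝ) ^ 2 * Real.log p ≤ (publicCoinComplexity (1 / 10) (rankProblem p n (n - 1)) : ℝ) ∧
      c * (n : ℝ) ^ 2 * Real.log p ≤ (publicCoinComplexity (1 / 10) (inverseProblem p n) : ℝ) ∧
      ∀ b : Fin n → ZMod p, b ≠ 0 →
        c * (n : ℝ) ^ 2 * Real.log p ≤
          (publicCoinComplexity (1 / 10) (solveLinearSystemProblem p n b) : ℝ) := by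
  refine ⟨1 / 8, by norm_num, 201, ?_⟩
  intro n _ p _ hn
  obtain ⟨N, rfl⟩ : ∃ N, n = N + 1 := ⟨n - 1, by omega⟩
  have hN : 200 ≤ N := by omega
  have hp : (2 : ℝ) ≤ p := by exact_mod_cast (Fact.out : p.Prime).two_le
  refine ⟨?_, ?_, fun b hb => ?_⟩
  · refine mul_log_le_of_pow_le hN ?_
    have h1 : (p : ℝ) ^ N.choose 2 ≤ (p : ℝ) ^ (N + 1).choose 2 :=
      pow_le_pow_right₀ (by linarith) (Nat.choose_le_choose 2 (Nat.le_succ N))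
    have h2 : (1 : ℝ) ≤ (4 * (p : ℝ) ^ (2 * (N + 1))) ^ 15 :=
      one_le_pow₀ (by linarith [one_le_pow₀ (by linarith : (1 : ℝ) ≤ p) (n := 2 * (N + 1))])
    refine h1.trans ((pow_choose_le_rankProblem (by omega)).trans ?_)
    refine mul_le_mul_of_nonneg_right ?_ (by positivity)
    linarith
  · refine mul_log_le_of_pow_le hN (pow_choose_le_of_inverse_entry (by omega)
      (R := 1) isUnit_one _ (fun x y h => h) fun x y h => ?_)
    rw [one_mul]
    exact decide_eq_true_iff
  -- With b = M e for the first unit vector e, the solution is (x + y)⁻¹ M e, whose first coordinate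
  -- is the top-left entry of (M⁻¹ (x + y))⁻¹.
  · obtain ⟨M, hM, rfl⟩ := exists_isUnit_mulVec_single hb
    have hMdet := (Matrix.isUnit_iff_isUnit_det M).1 hM
    refine mul_log_le_of_pow_le hN (pow_choose_le_of_inverse_entry (by omega)
      (R := M⁻¹) (Matrix.isUnit_nonsing_inv_iff.2 hM) _ (fun x y h => h) fun x y h => ?_)
    have hz := (Matrix.isUnit_iff_isUnit_det _).1 h
    refine decide_eq_true_iff.trans ?_
    have h1 : (M⁻¹ * (x + y))⁻¹ 0 0 = ((x + y)⁻¹.mulVec (M.mulVec (Pi.single 0 1))) 0 := by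
      rw [Matrix.mul_inv_rev, Matrix.nonsing_inv_nonsing_inv _ hMdet, Matrix.mulVec_mulVec]
      simp
    rw [h1]
    constructor
    · rintro ⟨t, ht, ht0⟩
      rw [← ht, Matrix.mulVec_mulVec, Matrix.nonsing_inv_mul _ hz, Matrix.one_mulVec, ht0]
    · intro h0
      refine ⟨_, ?_, h0⟩
      rw [Matrix.mulVec_mulVec, Matrix.mul_nonsing_inv _ hz, Matrix.one_mulVec]
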